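/- Let $\mathcal N$ be a smooth manifold of dimension $\mathfrak n$ carrying smooth hypersurface data $\{\gamma,\ell,\ell^{(2)},Y\}$. That is, $\gamma$ and $Y$ are smooth symmetric 2-covariant tensors, $\ell$ is a smooth covector, $\ell^{(2)}$ is a smooth function, and at every $p\in\mathcal N$ the symmetric bilinear form on $T_p\mathcal N\times\mathbb R$ $$\mathcal A\big((W,a),(Z,b)\big)=\gamma(W,Z)+a\,\ell(Z)+b\,\ell(W)+ab\,\ell^{(2)}$$ is non-degenerate. Let $P$ (symmetric 2-contravariant tensor), $n$ (vector field) and $n^{(2)}$ (function) be defined by the inverse contravariant form $$\mathcal A^{-1}\big((\alpha,a),(\beta,b)\big)=P(\alpha,\beta)+a\,n(\beta)+b\,n(\alpha)+ab\,n^{(2)}.$$ Define $$F=\tfrac12 d\ell,\quad s=F(n,\cdot),\quad U=\tfrac12 \pounds_n\gamma+\ell\otimes_s dn^{(2)},\quad r=Y(n,\cdot),\quad \kappa_n=-Y(n,n),$$ where $\ell\otimes_s dn^{(2)}=\tfrac12(\ell\otimes dn^{(2)}+dn^{(2)}\otimes\ell)$, and $\mathrm{tr}_PT=P^{ab}T_{ab}$.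 Let $\nabla^\circ$ be the metric hypersurface connection, i.e. the unique torsion-free connection on $\mathcal N$ with $$(\nabla^\circ_X\gamma)(Z,W)=-U(X,Z)\ell(W)-U(X,W)\ell(Z),\qquad (\nabla^\circ_X\ell)(Z)+(\nabla^\circ_Z\ell)(X)=-2\ell^{(2)}U(X,Z)$$ for all vector fields $X,Z,W$. Its curvature is $R^\circ(X,W)Z=\nabla^\circ_X\nabla^\circ_WZ-\nabla^\circ_W\nabla^\circ_XZ-\nabla^\circ_{[X,W]}Z$ and its Ricci tensor is $R^\circ_{ab}Z^aW^b=\mathrm{tr}\big(X\mapsto R^\circ(X,W)Z\big)$. Assume that the data are null, that is, $n^{(2)}=0$ on $\mathcal N$. The constraint tensor $\mathcal R$ is the symmetric tensor $$\begin{aligned}\mathcal R_{ab}={}&R^\circ_{(ab)}-2\pounds_nY_{ab}-(2\kappa_n+\mathrm{tr}_PU)Y_{ab}+\nabla^\circ_{(a}\big(s_{b)}+2r_{b)}\big)-2r_ar_b+4r_{(a}s_{b)}-s_as_b\\&-(\mathrm{tr}_PY)U_{ab}+2P^{cd}U_{d(a}\big(2Y_{b)c}+F_{b)c}\big),\end{aligned}$$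 where round brackets denote symmetrization with factor $\tfrac12$. Then, on all of $\mathcal N$, $$\mathcal R_{ab}n^a=-\nabla^\circ_b\kappa_n-\pounds_n(r_b-s_b)-(\mathrm{tr}_PU)(r_b-s_b)-\nabla^\circ_b(\mathrm{tr}_PU)+P^{cd}\big(\nabla^\circ_cU_{bd}-2U_{bd}s_c\big),$$ $$\mathcal R_{ab}n^an^b=-n(\mathrm{tr}_PU)+(\mathrm{tr}_PU)\kappa_n-P^{ab}P^{cd}U_{ac}U_{bd}.$$ -/

import Mathlib

open Bundle VectorField FiberBundle
open scoped Manifold ContDiff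

set_option linter.unusedSectionVars false

noncomputable section

section Linear

variable {V : Type*} [AddCommGroup V] [Module ℝ V] [TopologicalSpace V]

/-- The symmetric bilinear form
`𝒜((W, a), (Z, b)) = γ(W, Z) + a ℓ(Z) + b ℓ(W) + a b ℓ⁽²⁾` on `V × ℝ`. -/
def ambientForm (g : V →L[ℝ] V →L[ℝ] ℝ) (l : V →L[ℝ] ℝ) (c : ℝ) :
    LinearMap.BilinForm ℝ (V × ℝ) :=
  LinearMap.mk₂ ℝ (fun u v ↦ g u.1 v.1 + u.2 * l v.1 + v.2 * l u.1 + u.2 * v.2 * c)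
    (by intros; simp; ring) (by intros; simp; ring) (by intros; simp; ring)
    (by intros; simp; ring)

end Linear

section Calculus

variable {E : Type*} [NormedAddCommGroup E] [NormedSpace ℝ E]
  {H : Type*} [TopologicalSpace H] {I : ModelWithCorners ℝ E H}
  {M : Type*} [TopologicalSpace M] [ChartedSpace H M] [IsManifold I ∞ M]

/-- Lie derivative of a covector field: `(£_V θ)(w) = V(θ(W)) - θ([V, W])`, where `W` is a vector
field, smooth near `x`, extending the tangent vector `w` at `x`. -/
def lieDerivOne (V : ∀ x : M, TangentSpace I x) (θ : ∀ x : M, TangentSpace I x → ℝ) (x : M)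
    (w : TangentSpace I x) : ℝ :=
  d% (fun y ↦ θ y (extend E w y)) x (V x) - θ x (mlieBracket I V (extend E w) x)

/-- Lie derivative of a 2-covariant tensor field:
`(£_V T)(v, w) = V(T(X, W)) - T([V, X], w) - T(v, [V, W])`, where `X`, `W` extend `v`, `w`. -/
def lieDerivTwo (V : ∀ x : M, TangentSpace I x)
    (T : ∀ x : M, TangentSpace I x → TangentSpace I x → ℝ) (x : M)
    (v w : TangentSpace I x) : ℝ :=
  d% (fun y ↦ T y (extend E v y) (extend E w y)) x (V x)
    - T x (mlieBracket I V (extend E v) x) w - T x v (mlieBracket I V (extend E w) x)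

/-- Exterior derivative of a covector field:
`dθ(v, w) = v(θ(W)) - w(θ(X)) - θ([X, W])`, where `X`, `W` extend `v`, `w`. -/
def extDerivOne (θ : ∀ x : M, TangentSpace I x → ℝ) (x : M) (v w : TangentSpace I x) : ℝ :=
  d% (fun y ↦ θ y (extend E w y)) x v - d% (fun y ↦ θ y (extend E v y)) x w
    - θ x (mlieBracket I (extend E v) (extend E w) x)

/-- `(∇_u θ)(Z)` for a covector field `θ`, a vector field `Z` and a tangent vector `u` at `x`.
The Mathlib convention is that `cov Z x u` is `∇_u Z`. -/
def covDerivOneField (cov : CovariantDerivative I E (TangentSpace I : M → Type _))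
    (θ : ∀ x : M, TangentSpace I x → ℝ) (Z : ∀ x : M, TangentSpace I x) (x : M)
    (u : TangentSpace I x) : ℝ :=
  d% (fun y ↦ θ y (Z y)) x u - θ x (cov Z x u)

/-- `(∇_u T)(Z, W)` for a 2-covariant tensor field `T`, vector fields `Z`, `W` and a tangent
vector `u` at `x`. -/
def covDerivTwoField (cov : CovariantDerivative I E (TangentSpace I : M → Type _))
    (T : ∀ x : M, TangentSpace I x → TangentSpace I x → ℝ)
    (Z W : ∀ x : M, TangentSpace I x) (x : M) (u : TangentSpace I x) : ℝ :=
  d% (fun y ↦ T y (Z y) (W y)) x u - T x (cov Z x u) (W x) - T x (Z x) (cov W x u)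

/-- `∇_u θ_z`, that is `(∇_u θ)(z)`, at tangent vectors `u`, `z` at `x`. -/
def covDerivOne (cov : CovariantDerivative I E (TangentSpace I : M → Type _))
    (θ : ∀ x : M, TangentSpace I x → ℝ) (x : M) (u z : TangentSpace I x) : ℝ :=
  covDerivOneField cov θ (extend E z) x u

/-- `∇_u T_{zw}`, that is `(∇_u T)(z, w)`, at tangent vectors `u`, `z`, `w` at `x`. -/
def covDerivTwo (cov : CovariantDerivative I E (TangentSpace I : M → Type _))
    (T : ∀ x : M, TangentSpace I x → TangentSpace I x → ℝ) (x : M)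
    (u z w : TangentSpace I x) : ℝ :=
  covDerivTwoField cov T (extend E z) (extend E w) x u

/-- The curvature operator `R(X, W) Z = ∇_X ∇_W Z - ∇_W ∇_X Z - ∇_{[X, W]} Z` at `x`. -/
def curvatureField (cov : CovariantDerivative I E (TangentSpace I : M → Type _))
    (X W Z : ∀ x : M, TangentSpace I x) (x : M) : TangentSpace I x :=
  cov (fun y ↦ cov Z y (W y)) x (X x) - cov (fun y ↦ cov Z y (X y)) x (W x)
    - cov Z x (mlieBracket I X W x)

variable [FiniteDimensional ℝ E]

instance TangentSpace.instFiniteDimensionalReal (x : M) :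
    FiniteDimensional ℝ (TangentSpace I x) := inferInstanceAs (FiniteDimensional ℝ E)

/-- The Ricci tensor `Ric(z, w) = tr (u ↦ R(u, w) z)`, that is `R_{ab} = R^c_{acb}`. -/
def ricci (cov : CovariantDerivative I E (TangentSpace I : M → Type _)) (x : M)
    (z w : TangentSpace I x) : ℝ :=
  ∑ i, (Module.finBasis ℝ (TangentSpace I x)).coord i
    (curvatureField cov (extend E (Module.finBasis ℝ (TangentSpace I x) i)) (extend E w)
      (extend E z) x)

end Calculus

section Data

variable {E : Type*} [NormedAddCommGroup E] [NormedSpace ℝ E] {H : Type*} [TopologicalSpace H]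

/-- Metric hypersurface data: a smooth symmetric 2-covariant tensor `γ`, a smooth covector `ℓ` and
a smooth scalar `ℓ₂` (written `ℓ⁽²⁾` on paper) whose form `𝒜` is non-degenerate at each point. -/
structure MetricHypersurfaceData (I : ModelWithCorners ℝ E H) (M : Type*) [TopologicalSpace M]
    [ChartedSpace H M] [IsManifold I ∞ M] where
  γ : ∀ x : M, TangentSpace I x →L[ℝ] TangentSpace I x →L[ℝ] ℝ
  γ_symm : ∀ (x : M) (v w : TangentSpace I x), γ x v w = γ x w v
  γ_smooth : ContMDiff I (I.prod 𝓘(ℝ, E →L[ℝ] E →L[ℝ] ℝ)) ∞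
    (fun x ↦ TotalSpace.mk' (E →L[ℝ] E →L[ℝ] ℝ) x (γ x))
  ℓ : ∀ x : M, TangentSpace I x →L[ℝ] ℝ
  ℓ_smooth : ContMDiff I (I.prod 𝓘(ℝ, E →L[ℝ] ℝ)) ∞
    (fun x ↦ TotalSpace.mk' (E →L[ℝ] ℝ) x (ℓ x))
  ℓ₂ : M → ℝ
  ℓ₂_smooth : ContMDiff I 𝓘(ℝ) ∞ ℓ₂
  nondegenerate : ∀ x : M, (ambientForm (γ x) (ℓ x) (ℓ₂ x)).Nondegenerate

variable {I : ModelWithCorners ℝ E H} {M : Type*} [TopologicalSpace M] [ChartedSpace H M]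
  [IsManifold I ∞ M] [FiniteDimensional ℝ E]

namespace MetricHypersurfaceData

variable (D : MetricHypersurfaceData I M)

/-- The isomorphism from `T*_x M × ℝ` to `T_x M × ℝ` inverse to `u ↦ 𝒜(u, ·)`, where a pair `(α, a)`
acts on `(W, c)` as `α(W) + a c`. -/
def sharp (x : M) (α : Module.Dual ℝ (TangentSpace I x)) (a : ℝ) : TangentSpace I x × ℝ :=
  ((ambientForm (D.γ x) (D.ℓ x) (D.ℓ₂ x)).toDual (D.nondegenerate x)).symm
    (α.coprod (a • LinearMap.id))

/-- The contravariant form inverse to `𝒜`, at the pair `(α, a)`, `(β, b)`. -/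
def inverseForm (x : M) (α : Module.Dual ℝ (TangentSpace I x)) (a : ℝ)
    (β : Module.Dual ℝ (TangentSpace I x)) (b : ℝ) : ℝ :=
  β (D.sharp x α a).1 + b * (D.sharp x α a).2

/-- The 2-contravariant tensor `P`: `P(α, β)` is the inverse form at `(α, 0)`, `(β, 0)`. -/
def P (x : M) (α β : Module.Dual ℝ (TangentSpace I x)) : ℝ := D.inverseForm x α 0 β 0

/-- The vector field `n`: `β(n)` is the inverse form at `(0, 1)`, `(β, 0)`. -/
def n (x : M) : TangentSpace I x := (D.sharp x 0 1).1

/-- The scalar `n⁽²⁾`: the inverse form at `(0, 1)`, `(0, 1)`. -/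
def n₂ (x : M) : ℝ := D.inverseForm x 0 1 0 1

/-- The 2-form `F = (1/2) dℓ`. -/
def F (x : M) (v w : TangentSpace I x) : ℝ :=
  1 / 2 * extDerivOne (fun y v ↦ D.ℓ y v) x v w

/-- The covector `s = F(n, ·)`. -/
def s (x : M) (w : TangentSpace I x) : ℝ := D.F x (D.n x) w

/-- The symmetric tensor `U = (1/2) £_n γ + ℓ ⊗_s dn⁽²⁾`. -/
def U (x : M) (v w : TangentSpace I x) : ℝ :=
  1 / 2 * lieDerivTwo D.n (fun y v w ↦ D.γ y v w) x v w
    + 1 / 2 * (D.ℓ x v * d% D.n₂ x w + D.ℓ x w * d% D.n₂ x v)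

/-- The contraction `P^{ab} T_{ab}`. For symmetric `T` it is the trace `tr_P T`. -/
def contractP (x : M) (T : TangentSpace I x → TangentSpace I x → ℝ) : ℝ :=
  ∑ i, ∑ j, D.P x ((Module.finBasis ℝ (TangentSpace I x)).coord i)
    ((Module.finBasis ℝ (TangentSpace I x)).coord j)
    * T (Module.finBasis ℝ (TangentSpace I x) i) (Module.finBasis ℝ (TangentSpace I x) j)

/-! The facts down to `exists_isMetricHypersurfaceConnection` serve only to prove that the metric
hypersurface connection exists. -/


lemma ext_of_apply {x : M} {u v : TangentSpace I x}
    (h₁ : ∀ w, D.γ x u w = D.γ x v w) (h₂ : D.ℓ x u = D.ℓ x v) : u = v := by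
  have h := (D.nondegenerate x).1 (u - v, 0) (by
    rintro ⟨w, b⟩
    simp [ambientForm, h₁, h₂])
  exact sub_eq_zero.1 (congrArg Prod.fst h)

lemma sharp_spec (x : M) (α : Module.Dual ℝ (TangentSpace I x)) (a : ℝ) :
    (∀ w, D.γ x (D.sharp x α a).1 w + (D.sharp x α a).2 * D.ℓ x w = α w) ∧
      D.ℓ x (D.sharp x α a).1 + (D.sharp x α a).2 * D.ℓ₂ x = a := by
  have h (u : TangentSpace I x × ℝ) :
      ambientForm (D.γ x) (D.ℓ x) (D.ℓ₂ x) (D.sharp x α a) u = α u.1 + a * u.2 := by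
    have := LinearMap.BilinForm.apply_toDual_symm_apply (hB := D.nondegenerate x)
      (f := α.coprod (a • LinearMap.id)) (v := u)
    exact this.trans (by simp)
  generalize D.sharp x α a = p at h
  refine ⟨fun w ↦ ?_, ?_⟩
  · simpa [ambientForm] using h (w, 0)
  · simpa [ambientForm] using h (0, 1)

lemma γ_n (x : M) (w : TangentSpace I x) : D.γ x (D.n x) w = -D.n₂ x * D.ℓ x w := by
  have h := (D.sharp_spec x 0 1).1 w
  simp only [n, n₂, inverseForm, LinearMap.zero_apply] at *
  linarith

lemma ℓ_n (x : M) : D.ℓ x (D.n x) = 1 - D.n₂ x * D.ℓ₂ x := by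
  have h := (D.sharp_spec x 0 1).2
  simp only [n, n₂, inverseForm, LinearMap.zero_apply] at *
  linarith

lemma contMDiffAt_apply₂ {T : ∀ x : M, TangentSpace I x →L[ℝ] TangentSpace I x →L[ℝ] ℝ}
    {k : ℕ∞ω} {x : M}
    (hT : ContMDiffAt I (I.prod 𝓘(ℝ, E →L[ℝ] E →L[ℝ] ℝ)) k
      (fun x ↦ TotalSpace.mk' (E →L[ℝ] E →L[ℝ] ℝ) x (T x)) x)
    {Z W : ∀ x : M, TangentSpace I x} (hZ : CMDiffAt k (T% Z) x) (hW : CMDiffAt k (T% W) x) :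
    CMDiffAt k (fun y ↦ T y (Z y) (W y)) x := by
  have : ContMDiffAt I (I.prod 𝓘(ℝ)) k
      (fun m ↦ TotalSpace.mk' ℝ (E := Bundle.Trivial M ℝ) m (T m (Z m) (W m))) x := by
    apply ContMDiffAt.clm_bundle_apply₂ (F₁ := E) (F₂ := E)
    · exact hT
    · exact hZ
    · exact hW
  simp only [contMDiffAt_totalSpace] at this
  exact this.2

lemma contMDiffAt_apply₁ {θ : ∀ x : M, TangentSpace I x →L[ℝ] ℝ}
    {k : ℕ∞ω} {x : M}
    (hθ : ContMDiffAt I (I.prod 𝓘(ℝ, E →L[ℝ] ℝ)) k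
      (fun x ↦ TotalSpace.mk' (E →L[ℝ] ℝ) x (θ x)) x)
    {Z : ∀ x : M, TangentSpace I x} (hZ : CMDiffAt k (T% Z) x) :
    CMDiffAt k (fun y ↦ θ y (Z y)) x := by
  have : ContMDiffAt I (I.prod 𝓘(ℝ)) k
      (fun m ↦ TotalSpace.mk' ℝ (E := Bundle.Trivial M ℝ) m (θ m (Z m))) x := by
    apply ContMDiffAt.clm_bundle_apply (F₁ := E)
    · exact hθ
    · exact hZ
  simp only [contMDiffAt_totalSpace] at this
  exact this.2


lemma contMDiffAt_det {ι : Type*} [Fintype ι] [DecidableEq ι] {k : ℕ∞ω} {x : M}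
    {A : M → Matrix ι ι ℝ} (hA : ∀ i j, CMDiffAt k (fun y ↦ A y i j) x) :
    CMDiffAt k (fun y ↦ (A y).det) x := by
  simp only [Matrix.det_apply']
  exact ContMDiffAt.sum fun σ _ ↦ contMDiffAt_const.mul
    (ContMDiffAt.prod fun i _ ↦ hA _ _)

lemma contMDiffAt_of_solves {W : Type*} [NormedAddCommGroup W] [NormedSpace ℝ W]
    [FiniteDimensional ℝ W] {k : ℕ∞ω} {x : M} {A : M → LinearMap.BilinForm ℝ W}
    (hA : ∀ u v, CMDiffAt k (fun y ↦ A y u v) x) (hx : (A x).Nondegenerate)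
    {w : M → W} {f : W → ℝ} (hw : ∀ᶠ y in nhds x, ∀ v, A y v (w y) = f v) :
    CMDiffAt k w x := by
  classical
  let b := Module.finBasis ℝ W
  let G (y : M) : Matrix _ _ ℝ := Matrix.of fun i j ↦ A y (b i) (b j)
  have hG (i j) : CMDiffAt k (fun y ↦ G y i j) x := hA (b i) (b j)
  have hdet := contMDiffAt_det hG
  have hne : (G x).det ≠ 0 := by
    have h := (LinearMap.BilinForm.nondegenerate_iff_det_ne_zero b).1 hx
    have h' : LinearMap.BilinForm.toMatrix b (A x) = G x := by
      ext i j
      simp [G, LinearMap.BilinForm.toMatrix_apply]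
    rwa [h'] at h
  have hev : ∀ᶠ y in nhds x, (G y).det ≠ 0 := hdet.continuousAt.eventually_ne hne
  have key : w =ᶠ[nhds x] fun y ↦ ∑ i, ((G y).det⁻¹ *
      ((G y).updateCol i (fun j ↦ f (b j))).det) • b i := by
    filter_upwards [hw, hev] with y hy hy'
    have h1 : (G y).mulVec (b.repr (w y)) = fun j ↦ f (b j) := by
      ext j
      rw [← hy (b j)]
      conv_rhs => rw [← b.sum_repr (w y)]
      simp only [G, Matrix.mulVec, dotProduct, Matrix.of_apply, map_sum, map_smul, smul_eq_mul]
      exact Finset.sum_congr rfl fun i _ ↦ mul_comm _ _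
    have h2 (i) : b.repr (w y) i = (G y).det⁻¹ *
      ((G y).updateCol i (fun j ↦ f (b j))).det := by
      rw [← Matrix.cramer_apply, ← h1, Matrix.cramer_eq_adjugate_mulVec, Matrix.mulVec_mulVec,
        Matrix.adjugate_mul, Matrix.smul_mulVec, Matrix.one_mulVec]
      simp [hy']
    simp_rw [← h2]
    exact (b.sum_repr (w y)).symm
  refine ContMDiffAt.congr_of_eventuallyEq (ContMDiffAt.sum fun i _ ↦ ?_) key
  have h : CMDiffAt k (fun y ↦ ((G y).updateCol i (fun j ↦ f (b j))).det) x := by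
    apply contMDiffAt_det
    intro i' j
    by_cases h : j = i
    · subst h; simpa using contMDiffAt_const
    · simpa [Matrix.updateCol_ne h] using hG i' j
  exact ((hdet.inv₀ hne).mul h).smul contMDiffAt_const

lemma n_smooth_aux (x : M) : CMDiffAt ∞ (T% D.n) x ∧ CMDiffAt ∞ D.n₂ x := by
  let t := trivializationAt E (TangentSpace I : M → Type _) x
  have hx : x ∈ t.baseSet := FiberBundle.mem_baseSet_trivializationAt' x
  have hS (v : E) : CMDiffAt ∞ (T% (fun y ↦ t.symmL ℝ y v)) x := by
    rw [contMDiffAt_section]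
    refine (contMDiffAt_const (c := v)).congr_of_eventuallyEq ?_
    filter_upwards [t.open_baseSet.mem_nhds hx] with y hy
    change (t ⟨y, t.symmL ℝ y v⟩).2 = v
    rw [t.symmL_apply hy, t.apply_mk_symm hy]
  let A (y : M) : LinearMap.BilinForm ℝ (E × ℝ) :=
    (ambientForm (D.γ y) (D.ℓ y) (D.ℓ₂ y)).compl₁₂
      ((t.symmL ℝ y : E →ₗ[ℝ] TangentSpace I y).prodMap LinearMap.id)
      ((t.symmL ℝ y : E →ₗ[ℝ] TangentSpace I y).prodMap LinearMap.id)
  have hA (u v : E × ℝ) : CMDiffAt ∞ (fun y ↦ A y u v) x := by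
    simp only [A, ambientForm, LinearMap.compl₁₂_apply, LinearMap.mk₂_apply,
      LinearMap.prodMap_apply]
    have h1 := contMDiffAt_apply₂ (D.γ_smooth x) (hS u.1) (hS v.1)
    have h2 (w : E) := contMDiffAt_apply₁ (D.ℓ_smooth x) (hS w)
    have h3 (c : ℝ) : CMDiffAt ∞ (fun _ : M ↦ c) x := contMDiffAt_const
    exact ((h1.add ((h3 u.2).mul (h2 v.1))).add ((h3 v.2).mul (h2 u.1))).add
      ((h3 (u.2 * v.2)).mul (D.ℓ₂_smooth x))
  have hnd : (A x).Nondegenerate := by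
    let e : (E × ℝ) ≃ₗ[ℝ] TangentSpace I x × ℝ :=
      (t.continuousLinearEquivAt ℝ x hx).symm.toLinearEquiv.prodCongr (LinearEquiv.refl ℝ ℝ)
    have h := (D.nondegenerate x).congr e.symm
    have he (u : E × ℝ) : e u = (t.symmL ℝ x u.1, u.2) :=
      Prod.ext (t.symmL_apply hx u.1).symm rfl
    have hAe : A x = LinearMap.BilinForm.congr e.symm
        (ambientForm (D.γ x) (D.ℓ x) (D.ℓ₂ x)) := by
      refine LinearMap.ext₂ fun u v ↦ ?_
      rw [LinearMap.BilinForm.congr_apply, LinearEquiv.symm_symm, he, he]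
      rfl
    rwa [hAe]
  have hsol : ∀ᶠ y in nhds x, ∀ v, A y v ((t ⟨y, D.n y⟩).2, D.n₂ y) = v.2 := by
    filter_upwards [t.open_baseSet.mem_nhds hx] with y hy v
    have h1 := D.γ_n y (t.symmL ℝ y v.1)
    have h2 := D.ℓ_n y
    rw [D.γ_symm] at h1
    have h3 : t.symmL ℝ y (t ⟨y, D.n y⟩).2 = D.n y := by
      rw [t.symmL_apply hy, t.symm_apply_apply_mk hy]
    simp only [A, ambientForm, LinearMap.compl₁₂_apply, LinearMap.mk₂_apply,
      LinearMap.prodMap_apply, LinearMap.id_apply, ContinuousLinearMap.coe_coe, h3, h1, h2]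
    ring
  have := contMDiffAt_of_solves hA hnd hsol
  refine ⟨?_, ?_⟩
  · rw [contMDiffAt_section]
    exact contDiff_fst.contMDiff.contMDiffAt.comp x this
  · exact contDiff_snd.contMDiff.contMDiffAt.comp x this


section Tensorial

variable {x : M} {X Z W Z' : ∀ x : M, TangentSpace I x} {f : M → ℝ}

lemma mdiff_n : MDiffAt (T% D.n) x := (D.n_smooth_aux x).1.mdifferentiableAt (by simp)

lemma mdiff_n₂ : MDiffAt D.n₂ x := (D.n_smooth_aux x).2.mdifferentiableAt (by simp)

lemma mdiff_γ (hZ : MDiffAt (T% Z) x) (hW : MDiffAt (T% W) x) :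
    MDiffAt (fun y ↦ D.γ y (Z y) (W y)) x := by
  have : MDifferentiableAt I (I.prod 𝓘(ℝ))
      (fun m ↦ TotalSpace.mk' ℝ (E := Bundle.Trivial M ℝ) m (D.γ m (Z m) (W m))) x := by
    apply MDifferentiableAt.clm_bundle_apply₂ (F₁ := E) (F₂ := E)
    · exact (D.γ_smooth x).mdifferentiableAt (by simp)
    · exact hZ
    · exact hW
  simp only [mdifferentiableAt_totalSpace] at this
  exact this.2

lemma mdiff_ℓ (hZ : MDiffAt (T% Z) x) : MDiffAt (fun y ↦ D.ℓ y (Z y)) x := by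
  have : MDifferentiableAt I (I.prod 𝓘(ℝ))
      (fun m ↦ TotalSpace.mk' ℝ (E := Bundle.Trivial M ℝ) m (D.ℓ m (Z m))) x := by
    apply MDifferentiableAt.clm_bundle_apply (F₁ := E)
    · exact (D.ℓ_smooth x).mdifferentiableAt (by simp)
    · exact hZ
  simp only [mdifferentiableAt_totalSpace] at this
  exact this.2

lemma dγ_smul (hf : MDiffAt f x) (hZ : MDiffAt (T% Z) x) (hW : MDiffAt (T% W) x)
    (v : TangentSpace I x) :
    d% (fun y ↦ D.γ y ((f • Z) y) (W y)) x v
      = f x * d% (fun y ↦ D.γ y (Z y) (W y)) x v + D.γ x (Z x) (W x) * d% f x v := by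
  have : (fun y ↦ D.γ y ((f • Z) y) (W y)) = f * (fun y ↦ D.γ y (Z y) (W y)) := by
    ext y; simp
  rw [this, mvfderiv_mul hf (D.mdiff_γ hZ hW)]
  simp

lemma dγ_add (hZ : MDiffAt (T% Z) x) (hZ' : MDiffAt (T% Z') x) (hW : MDiffAt (T% W) x)
    (v : TangentSpace I x) :
    d% (fun y ↦ D.γ y ((Z + Z') y) (W y)) x v
      = d% (fun y ↦ D.γ y (Z y) (W y)) x v + d% (fun y ↦ D.γ y (Z' y) (W y)) x v := by
  have : (fun y ↦ D.γ y ((Z + Z') y) (W y))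
      = (fun y ↦ D.γ y (Z y) (W y)) + (fun y ↦ D.γ y (Z' y) (W y)) := by
    ext y; simp
  rw [this, mvfderiv_add (D.mdiff_γ hZ hW) (D.mdiff_γ hZ' hW)]
  simp

lemma dγ_comm (v : TangentSpace I x) :
    d% (fun y ↦ D.γ y (Z y) (W y)) x v = d% (fun y ↦ D.γ y (W y) (Z y)) x v := by
  simp_rw [D.γ_symm _ (Z _)]

lemma dℓ_smul (hf : MDiffAt f x) (hZ : MDiffAt (T% Z) x) (v : TangentSpace I x) :
    d% (fun y ↦ D.ℓ y ((f • Z) y)) x v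
      = f x * d% (fun y ↦ D.ℓ y (Z y)) x v + D.ℓ x (Z x) * d% f x v := by
  have : (fun y ↦ D.ℓ y ((f • Z) y)) = f * (fun y ↦ D.ℓ y (Z y)) := by
    ext y; simp
  rw [this, mvfderiv_mul hf (D.mdiff_ℓ hZ)]
  simp

lemma dℓ_add (hZ : MDiffAt (T% Z) x) (hZ' : MDiffAt (T% Z') x) (v : TangentSpace I x) :
    d% (fun y ↦ D.ℓ y ((Z + Z') y)) x v
      = d% (fun y ↦ D.ℓ y (Z y)) x v + d% (fun y ↦ D.ℓ y (Z' y)) x v := by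
  have : (fun y ↦ D.ℓ y ((Z + Z') y)) = (fun y ↦ D.ℓ y (Z y)) + (fun y ↦ D.ℓ y (Z' y)) := by
    ext y; simp
  rw [this, mvfderiv_add (D.mdiff_ℓ hZ) (D.mdiff_ℓ hZ')]
  simp

/-- `(£_n γ)(X, Z)` at `x`, for vector fields. -/
def lieγ (x : M) (X Z : ∀ x : M, TangentSpace I x) : ℝ :=
  d% (fun y ↦ D.γ y (X y) (Z y)) x (D.n x)
    - D.γ x (mlieBracket I D.n X x) (Z x) - D.γ x (X x) (mlieBracket I D.n Z x)

lemma lieγ_comm (x : M) (X Z : ∀ x : M, TangentSpace I x) : D.lieγ x X Z = D.lieγ x Z X := by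
  simp only [lieγ]
  rw [dγ_comm, D.γ_symm x (mlieBracket I D.n X x), D.γ_symm x (X x)]
  ring

lemma lieγ_tensorial₁ (x : M) (Z : ∀ x : M, TangentSpace I x) (hZ : MDiffAt (T% Z) x) :
    TensorialAt I E (D.lieγ x · Z) x where
  smul hf hX := by
    rw [lieγ, D.dγ_smul hf hX hZ, mlieBracket_smul_right hf hX]
    simp [lieγ]
    ring
  add hX hX' := by
    rw [lieγ, D.dγ_add hX hX' hZ, mlieBracket_add_right hX hX']
    simp [lieγ]
    ring

lemma lieγ_tensorial₂ (x : M) (Z : ∀ x : M, TangentSpace I x) (hZ : MDiffAt (T% Z) x) :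
    TensorialAt I E (D.lieγ x Z ·) x := by
  simpa only [D.lieγ_comm x Z] using D.lieγ_tensorial₁ x Z hZ

/-- `dℓ(X, Z)` at `x`, for vector fields. -/
def dℓ (x : M) (X Z : ∀ x : M, TangentSpace I x) : ℝ :=
  d% (fun y ↦ D.ℓ y (Z y)) x (X x) - d% (fun y ↦ D.ℓ y (X y)) x (Z x)
    - D.ℓ x (mlieBracket I X Z x)

lemma dℓ_swap (x : M) (X Z : ∀ x : M, TangentSpace I x) : D.dℓ x X Z = - D.dℓ x Z X := by
  simp only [dℓ]
  rw [mlieBracket_swap_apply, map_neg]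
  ring

lemma dℓ_tensorial₂ (x : M) (X : ∀ x : M, TangentSpace I x) (_hX : MDiffAt (T% X) x) :
    TensorialAt I E (D.dℓ x X ·) x where
  smul hf hZ := by
    rw [dℓ, D.dℓ_smul hf hZ, mlieBracket_smul_right hf hZ]
    simp [dℓ]
    ring
  add hZ hZ' := by
    rw [dℓ, D.dℓ_add hZ hZ', mlieBracket_add_right hZ hZ']
    simp [dℓ]
    ring

lemma dℓ_tensorial₁ (x : M) (X : ∀ x : M, TangentSpace I x) (hX : MDiffAt (T% X) x) :
    TensorialAt I E (D.dℓ x · X) x where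
  smul hf hZ := by
    rw [dℓ_swap, (D.dℓ_tensorial₂ x X hX).smul hf hZ, D.dℓ_swap x X]; simp
  add hZ hZ' := by
    rw [dℓ_swap, (D.dℓ_tensorial₂ x X hX).add hZ hZ', D.dℓ_swap x X, D.dℓ_swap x X]; ring

lemma U_apply (hX : MDiffAt (T% X) x) (hZ : MDiffAt (T% Z) x) :
    D.U x (X x) (Z x) = 1 / 2 * D.lieγ x X Z
      + 1 / 2 * (D.ℓ x (X x) * d% D.n₂ x (Z x) + D.ℓ x (Z x) * d% D.n₂ x (X x)) := by
  have : D.lieγ x (extend E (X x)) (extend E (Z x)) = D.lieγ x X Z :=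
    TensorialAt.pointwise₂ (D.lieγ_tensorial₁ x) (D.lieγ_tensorial₂ x)
      (mdifferentiableAt_extend ..) hX (mdifferentiableAt_extend ..) hZ (by simp) (by simp)
  rw [U, ← this]
  simp [lieγ, lieDerivTwo]

lemma F_apply (hX : MDiffAt (T% X) x) (hZ : MDiffAt (T% Z) x) :
    D.F x (X x) (Z x) = 1 / 2 * D.dℓ x X Z := by
  have : D.dℓ x (extend E (X x)) (extend E (Z x)) = D.dℓ x X Z :=
    TensorialAt.pointwise₂ (D.dℓ_tensorial₁ x) (D.dℓ_tensorial₂ x)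
      (mdifferentiableAt_extend ..) hX (mdifferentiableAt_extend ..) hZ (by simp) (by simp)
  rw [F, ← this]
  simp [dℓ, extDerivOne]

/-- The Koszul-type expression for `γ(∇_X Z, W)`; auxiliary, for the existence of the connection. -/
def koszul (x : M) (Z X W : ∀ x : M, TangentSpace I x) : ℝ :=
  1 / 2 * (d% (fun y ↦ D.γ y (Z y) (W y)) x (X x) + d% (fun y ↦ D.γ y (X y) (W y)) x (Z x)
    - d% (fun y ↦ D.γ y (X y) (Z y)) x (W x) + D.γ x (mlieBracket I X Z x) (W x)
    - D.γ x (mlieBracket I X W x) (Z x) - D.γ x (mlieBracket I Z W x) (X x))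
    + D.U x (X x) (Z x) * D.ℓ x (W x)


lemma dγ_smul' (hf : MDiffAt f x) (hZ : MDiffAt (T% Z) x) (hW : MDiffAt (T% W) x)
    (v : TangentSpace I x) :
    d% (fun y ↦ D.γ y (W y) ((f • Z) y)) x v
      = f x * d% (fun y ↦ D.γ y (W y) (Z y)) x v + D.γ x (W x) (Z x) * d% f x v := by
  rw [D.dγ_comm, D.dγ_smul hf hZ hW, D.dγ_comm, D.γ_symm x]

lemma dγ_add' (hZ : MDiffAt (T% Z) x) (hZ' : MDiffAt (T% Z') x) (hW : MDiffAt (T% W) x)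
    (v : TangentSpace I x) :
    d% (fun y ↦ D.γ y (W y) ((Z + Z') y)) x v
      = d% (fun y ↦ D.γ y (W y) (Z y)) x v + d% (fun y ↦ D.γ y (W y) (Z' y)) x v := by
  rw [D.dγ_comm, D.dγ_add hZ hZ' hW, D.dγ_comm, D.dγ_comm (Z := Z')]

lemma exists_U (x : M) : ∃ L : TangentSpace I x →L[ℝ] TangentSpace I x →L[ℝ] ℝ,
    ∀ v w, D.U x v w = L v w := by
  refine ⟨(1 / 2 : ℝ) • TensorialAt.mkHom₂ (D.lieγ x) x (D.lieγ_tensorial₁ x)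
    (D.lieγ_tensorial₂ x) + (1 / 2 : ℝ) • ((D.ℓ x).smulRight (d% D.n₂ x)
      + (d% D.n₂ x).smulRight (D.ℓ x)), fun v w ↦ ?_⟩
  simp only [U, lieDerivTwo, add_apply, smul_apply,
    TensorialAt.mkHom₂_apply_eq_extend, lieγ, extend_apply_self, smul_eq_mul,
    ContinuousLinearMap.smulRight_apply]
  ring

lemma U_symm (x : M) (v w : TangentSpace I x) : D.U x v w = D.U x w v := by
  simp only [U, lieDerivTwo]
  rw [D.dγ_comm, D.γ_symm x _ w, D.γ_symm x v]
  ring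

lemma exists_F (x : M) : ∃ L : TangentSpace I x →L[ℝ] TangentSpace I x →L[ℝ] ℝ,
    ∀ v w, D.F x v w = L v w := by
  refine ⟨(1 / 2 : ℝ) • TensorialAt.mkHom₂ (D.dℓ x) x (D.dℓ_tensorial₁ x)
    (D.dℓ_tensorial₂ x), fun v w ↦ ?_⟩
  simp [F, extDerivOne, TensorialAt.mkHom₂_apply_eq_extend, dℓ]

lemma koszul_tensorial₁ (hZ : MDiffAt (T% Z) x) (W : ∀ x : M, TangentSpace I x)
    (hW : MDiffAt (T% W) x) : TensorialAt I E (D.koszul x Z · W) x where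
  smul {f X} hf hX := by
    obtain ⟨L, hL⟩ := D.exists_U x
    rw [koszul, D.dγ_smul hf hX hW, D.dγ_smul hf hX hZ, mlieBracket_smul_left hf hX,
      mlieBracket_smul_left hf hX]
    simp [koszul, hL, D.γ_symm x (X x)]
    ring
  add {X X'} hX hX' := by
    obtain ⟨L, hL⟩ := D.exists_U x
    rw [koszul, D.dγ_add hX hX' hW, D.dγ_add hX hX' hZ, mlieBracket_add_left hX hX',
      mlieBracket_add_left hX hX']
    simp [koszul, hL]
    ring

lemma koszul_tensorial₂ (hZ : MDiffAt (T% Z) x) (X : ∀ x : M, TangentSpace I x)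
    (hX : MDiffAt (T% X) x) : TensorialAt I E (D.koszul x Z X ·) x where
  smul {f W} hf hW := by
    rw [koszul, D.dγ_smul' hf hW hZ, D.dγ_smul' hf hW hX, mlieBracket_smul_right hf hW,
      mlieBracket_smul_right hf hW]
    simp [koszul, D.γ_symm x (W x)]
    ring
  add {W W'} hW hW' := by
    rw [koszul, D.dγ_add' hW hW' hZ, D.dγ_add' hW hW' hX, mlieBracket_add_right hW hW',
      mlieBracket_add_right hW hW']
    simp [koszul]
    ring

lemma koszul_smul (hf : MDiffAt f x) (hZ : MDiffAt (T% Z) x) (hX : MDiffAt (T% X) x)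
    (hW : MDiffAt (T% W) x) :
    D.koszul x (f • Z) X W = f x * D.koszul x Z X W + d% f x (X x) * D.γ x (Z x) (W x) := by
  obtain ⟨L, hL⟩ := D.exists_U x
  rw [koszul, D.dγ_smul hf hZ hW, D.dγ_smul' hf hZ hX, mlieBracket_smul_left hf hZ,
    mlieBracket_smul_right hf hZ]
  simp [koszul, hL, D.γ_symm x (X x)]
  ring

lemma koszul_add (hZ : MDiffAt (T% Z) x) (hZ' : MDiffAt (T% Z') x) (hX : MDiffAt (T% X) x)
    (hW : MDiffAt (T% W) x) :
    D.koszul x (Z + Z') X W = D.koszul x Z X W + D.koszul x Z' X W := by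
  obtain ⟨L, hL⟩ := D.exists_U x
  rw [koszul, D.dγ_add hZ hZ' hW, D.dγ_add' hZ hZ' hX, mlieBracket_add_left hZ hZ',
    mlieBracket_add_right hZ hZ']
  simp [koszul, hL]
  ring

/-- The expression for `ℓ(∇_v Z)`; auxiliary, for the existence of the connection. -/
def transv (x : M) (Z : ∀ x : M, TangentSpace I x) (v : TangentSpace I x) : ℝ :=
  d% (fun y ↦ D.ℓ y (Z y)) x v - D.F x v (Z x) + D.ℓ₂ x * D.U x v (Z x)

lemma koszul_n (hZ : MDiffAt (T% Z) x) (hX : MDiffAt (T% X) x) :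
    D.koszul x Z X D.n + D.n₂ x * D.transv x Z (X x) = 0 := by
  have h (Z : ∀ x : M, TangentSpace I x) (hZ : MDiffAt (T% Z) x) (v : TangentSpace I x) :
      d% (fun y ↦ D.γ y (Z y) (D.n y)) x v =
        -(d% D.n₂ x v * D.ℓ x (Z x) + D.n₂ x * d% (fun y ↦ D.ℓ y (Z y)) x v) := by
    have : (fun y ↦ D.γ y (Z y) (D.n y)) = -(D.n₂ * fun y ↦ D.ℓ y (Z y)) := by
      ext y; simp [D.γ_symm y (Z y), D.γ_n]
    rw [this, mvfderiv_neg, mvfderiv_mul D.mdiff_n₂ (D.mdiff_ℓ hZ)]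
    simp; ring
  have b (V : ∀ x : M, TangentSpace I x) : mlieBracket I V D.n x = -mlieBracket I D.n V x :=
    mlieBracket_swap_apply
  rw [koszul, transv, h Z hZ, h X hX, D.γ_symm x _ (D.n x), D.γ_n, D.ℓ_n, D.F_apply hX hZ, b, b]
  have hU := D.U_apply hX hZ
  rw [lieγ, D.γ_symm x (X x)] at hU
  simp only [dℓ, map_neg, neg_apply] at hU ⊢
  linear_combination hU

lemma exists_cov (hZ : MDiffAt (T% Z) x) : ∃ C : TangentSpace I x →L[ℝ] TangentSpace I x,
    (∀ X W : ∀ x : M, TangentSpace I x, MDiffAt (T% X) x → MDiffAt (T% W) x →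
      D.γ x (C (X x)) (W x) = D.koszul x Z X W) ∧ ∀ v, D.ℓ x (C v) = D.transv x Z v := by
  let K := TensorialAt.mkHom₂ (D.koszul x Z) x (D.koszul_tensorial₁ hZ) (D.koszul_tensorial₂ hZ)
  have hK (X W : ∀ x : M, TangentSpace I x) (hX : MDiffAt (T% X) x) (hW : MDiffAt (T% W) x) :
      K (X x) (W x) = D.koszul x Z X W :=
    TensorialAt.mkHom₂_apply (D.koszul_tensorial₁ hZ) (D.koszul_tensorial₂ hZ) hX hW
  have hex (v : TangentSpace I x) :
      ∃ u, (∀ w, D.γ x u w = K v w) ∧ D.ℓ x u = D.transv x Z v := by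
    have hs := D.sharp_spec x (K v : TangentSpace I x →ₗ[ℝ] ℝ) (D.transv x Z v)
    set p := D.sharp x (K v : TangentSpace I x →ₗ[ℝ] ℝ) (D.transv x Z v)
    have h0 : K v (D.n x) + D.n₂ x * D.transv x Z v = 0 := by
      have h1 := hK (extend E v) D.n (mdifferentiableAt_extend ..) D.mdiff_n
      have h2 := D.koszul_n hZ (X := extend E v) (mdifferentiableAt_extend ..)
      rw [← h1] at h2
      simpa using h2
    have hp : p.2 = 0 := by
      have h1 := hs.1 (D.n x)
      have h2 := hs.2
      rw [D.γ_symm, D.γ_n, D.ℓ_n] at h1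
      simp only [ContinuousLinearMap.coe_coe] at h1
      linear_combination h1 + D.n₂ x * h2 + h0
    refine ⟨p.1, fun w ↦ ?_, ?_⟩
    · simpa [hp] using hs.1 w
    · simpa [hp] using hs.2
  choose u hu₁ hu₂ using hex
  obtain ⟨L, hL⟩ := D.exists_U x
  obtain ⟨L', hL'⟩ := D.exists_F x
  have : T2Space (TangentSpace I x) := inferInstanceAs (T2Space E)
  let C : TangentSpace I x →ₗ[ℝ] TangentSpace I x :=
    { toFun := u
      map_add' := fun v w ↦ D.ext_of_apply (fun z ↦ by simp [hu₁])
        (by simp [hu₂, transv, hL, hL']; ring)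
      map_smul' := fun c v ↦ D.ext_of_apply (fun z ↦ by simp [hu₁])
        (by simp [hu₂, transv, hL, hL']; ring) }
  refine ⟨LinearMap.toContinuousLinearMap C, fun X W hX hW ↦ ?_, fun v ↦ hu₂ v⟩
  exact (hu₁ _ _).trans (hK X W hX hW)

/-- The defining properties of the metric hypersurface connection: it has no torsion,
`(∇_X γ)(Z, W) = -U(X, Z) ℓ(W) - U(X, W) ℓ(Z)` and
`(∇_X ℓ)(Z) + (∇_Z ℓ)(X) = -2 ℓ⁽²⁾ U(X, Z)`. -/
structure IsMetricHypersurfaceConnection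
    (cov : CovariantDerivative I E (TangentSpace I : M → Type _)) : Prop where
  torsion_eq_zero : cov.torsion = 0
  covDeriv_γ : ∀ (x : M) (X Z W : ∀ x : M, TangentSpace I x),
    MDiffAt (T% X) x → MDiffAt (T% Z) x → MDiffAt (T% W) x →
    covDerivTwoField cov (fun y v w ↦ D.γ y v w) Z W x (X x)
      = -D.U x (X x) (Z x) * D.ℓ x (W x) - D.U x (X x) (W x) * D.ℓ x (Z x)
  covDeriv_ℓ : ∀ (x : M) (X Z : ∀ x : M, TangentSpace I x),
    MDiffAt (T% X) x → MDiffAt (T% Z) x →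
    covDerivOneField cov (fun y v ↦ D.ℓ y v) Z x (X x)
      + covDerivOneField cov (fun y v ↦ D.ℓ y v) X x (Z x) = -2 * D.ℓ₂ x * D.U x (X x) (Z x)

theorem exists_isMetricHypersurfaceConnection :
    ∃ cov : CovariantDerivative I E (TangentSpace I : M → Type _),
      D.IsMetricHypersurfaceConnection cov := by
  classical
  let C (Z : ∀ x : M, TangentSpace I x) (x : M) : TangentSpace I x →L[ℝ] TangentSpace I x :=
    if hZ : MDiffAt (T% Z) x then (D.exists_cov hZ).choose else 0
  have hC₁ {x : M} {Z X W : ∀ x : M, TangentSpace I x} (hZ : MDiffAt (T% Z) x)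
      (hX : MDiffAt (T% X) x) (hW : MDiffAt (T% W) x) :
      D.γ x (C Z x (X x)) (W x) = D.koszul x Z X W := by
    simp only [C, dif_pos hZ]
    exact (D.exists_cov hZ).choose_spec.1 X W hX hW
  have hC₂ {x : M} {Z : ∀ x : M, TangentSpace I x} (hZ : MDiffAt (T% Z) x)
      (v : TangentSpace I x) : D.ℓ x (C Z x v) = D.transv x Z v := by
    simp only [C, dif_pos hZ]
    exact (D.exists_cov hZ).choose_spec.2 v
  have hC₁' {x : M} {Z : ∀ x : M, TangentSpace I x} (hZ : MDiffAt (T% Z) x)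
      (v w : TangentSpace I x) :
      D.γ x (C Z x v) w = D.koszul x Z (extend E v) (extend E w) := by
    simpa using hC₁ hZ (X := extend E v) (W := extend E w)
      (mdifferentiableAt_extend ..) (mdifferentiableAt_extend ..)
  let cov : CovariantDerivative I E (TangentSpace I : M → Type _) :=
    { toFun := C
      isCovariantDerivativeOnUniv :=
        { add := by
            intro Z Z' x hZ hZ' _
            obtain ⟨L, hL⟩ := D.exists_U x
            obtain ⟨L', hL'⟩ := D.exists_F x
            have hs : MDiffAt (T% (Z + Z')) x := mdifferentiableAt_add_section hZ hZ'
            ext v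
            refine D.ext_of_apply (fun w ↦ ?_) ?_
            · simp only [add_apply, map_add]
              rw [hC₁' hs, hC₁' hZ, hC₁' hZ', D.koszul_add hZ hZ'
                (mdifferentiableAt_extend ..) (mdifferentiableAt_extend ..)]
            · simp only [add_apply, map_add]
              rw [hC₂ hs, hC₂ hZ, hC₂ hZ', transv, D.dℓ_add hZ hZ']
              simp [transv, hL, hL']
              ring
          leibniz := by
            intro Z f x hZ hf _
            obtain ⟨L, hL⟩ := D.exists_U x
            obtain ⟨L', hL'⟩ := D.exists_F x
            have hs : MDiffAt (T% (f • Z)) x := hf.smul_section hZ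
            ext v
            refine D.ext_of_apply (fun w ↦ ?_) ?_
            · simp only [add_apply, map_add, smul_apply, map_smul, smul_eq_mul,
                ContinuousLinearMap.smulRight_apply]
              rw [hC₁' hs, hC₁' hZ, D.koszul_smul hf hZ
                (mdifferentiableAt_extend ..) (mdifferentiableAt_extend ..)]
              simp
            · simp only [add_apply, map_add, smul_apply, map_smul, smul_eq_mul,
                ContinuousLinearMap.smulRight_apply]
              rw [hC₂ hs, hC₂ hZ, transv, D.dℓ_smul hf hZ]
              simp [transv, hL, hL']
              ring } }
  refine ⟨cov, ?_, ?_, ?_⟩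
  · rw [CovariantDerivative.torsion_eq_zero_iff]
    intro X Z x hX hZ
    refine D.ext_of_apply (fun w ↦ ?_) ?_
    · have h1 := hC₁ hZ hX (W := extend E w) (mdifferentiableAt_extend ..)
      have h2 := hC₁ hX hZ (W := extend E w) (mdifferentiableAt_extend ..)
      have h3 : mlieBracket I Z X x = - mlieBracket I X Z x := mlieBracket_swap_apply
      rw [koszul] at h1 h2
      rw [D.U_symm, D.dγ_comm (Z := Z) (W := X), h3] at h2
      simp only [extend_apply_self, map_neg, neg_apply] at h1 h2
      simp only [map_sub, sub_apply]
      linear_combination h1 - h2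
    · have h1 := hC₂ hZ (X x)
      have h2 := hC₂ hX (Z x)
      rw [transv] at h1 h2
      rw [D.F_apply hX hZ, dℓ] at h1
      rw [D.F_apply hZ hX, D.dℓ_swap, dℓ, D.U_symm] at h2
      simp only [map_sub]
      linear_combination h1 - h2
  · intro x X Z W hX hZ hW
    have h1 := hC₁ hZ hX hW
    have h2 := hC₁ hW hX hZ
    rw [koszul] at h1 h2
    have h3 : mlieBracket I W Z x = - mlieBracket I Z W x := mlieBracket_swap_apply
    rw [D.dγ_comm (Z := W) (W := Z), h3] at h2
    simp only [map_neg, neg_apply] at h2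
    simp only [covDerivTwoField]
    rw [D.γ_symm x (Z x)]
    linear_combination - h1 - h2
  · intro x X Z hX hZ
    have h1 := hC₂ hZ (X x)
    have h2 := hC₂ hX (Z x)
    rw [transv] at h1 h2
    rw [D.F_apply hX hZ] at h1
    rw [D.F_apply hZ hX, D.dℓ_swap, D.U_symm] at h2
    simp only [covDerivOneField]
    linear_combination - h1 - h2

theorem IsMetricHypersurfaceConnection.unique
    {cov cov' : CovariantDerivative I E (TangentSpace I : M → Type _)}
    (h : D.IsMetricHypersurfaceConnection cov) (h' : D.IsMetricHypersurfaceConnection cov')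
    (hZ : MDiffAt (T% Z) x) : cov Z x = cov' Z x := by
  have key (c : CovariantDerivative I E (TangentSpace I : M → Type _))
      (h : D.IsMetricHypersurfaceConnection c) (X : ∀ x : M, TangentSpace I x)
      (hX : MDiffAt (T% X) x) :
      (∀ W : ∀ x : M, TangentSpace I x, MDiffAt (T% W) x →
        D.γ x (c Z x (X x)) (W x) = D.koszul x Z X W)
      ∧ D.ℓ x (c Z x (X x)) = D.transv x Z (X x) := by
    have ht {X Y : ∀ x : M, TangentSpace I x} (hX : MDiffAt (T% X) x) (hY : MDiffAt (T% Y) x) :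
        c Y x (X x) - c X x (Y x) = mlieBracket I X Y x :=
      c.torsion_eq_zero_iff.1 h.torsion_eq_zero hX hY
    refine ⟨fun W hW ↦ ?_, ?_⟩
    · have a1 := h.covDeriv_γ x X Z W hX hZ hW
      have a2 := h.covDeriv_γ x Z X W hZ hX hW
      have a3 := h.covDeriv_γ x W X Z hW hX hZ
      have t1 := congrArg (fun v ↦ D.γ x v (W x)) (ht hX hZ)
      have t2 := congrArg (fun v ↦ D.γ x v (Z x)) (ht hX hW)
      have t3 := congrArg (fun v ↦ D.γ x v (X x)) (ht hZ hW)
      rw [D.U_symm x (Z x) (X x)] at a2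
      rw [D.U_symm x (W x) (X x), D.U_symm x (W x) (Z x)] at a3
      simp only [covDerivTwoField, D.γ_symm x (Z x), D.γ_symm x (X x), map_sub, sub_apply]
        at a1 a2 a3 t1 t2 t3
      rw [koszul]
      linear_combination (-1 / 2) * a1 - (1 / 2) * a2 + (1 / 2) * a3 + (1 / 2) * t1
        - (1 / 2) * t2 - (1 / 2) * t3
    · have a1 := h.covDeriv_ℓ x X Z hX hZ
      have t1 := congrArg (D.ℓ x) (ht hX hZ)
      simp only [covDerivOneField, map_sub] at a1 t1
      rw [transv, D.F_apply hX hZ, dℓ]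
      linear_combination (-1 / 2) * a1 + (1 / 2) * t1
  ext v
  refine D.ext_of_apply (fun w ↦ ?_) ?_
  · have hv := mdifferentiableAt_extend I E v
    have hw := mdifferentiableAt_extend I E w
    simpa using ((key cov h _ hv).1 _ hw).trans ((key cov' h' _ hv).1 _ hw).symm
  · have hv := mdifferentiableAt_extend I E v
    simpa using (key cov h _ hv).2.trans (key cov' h' _ hv).2.symm

end Tensorial

/-- The metric hypersurface connection `∇°`: the torsion-free connection determined by the
properties `IsMetricHypersurfaceConnection`. -/
def connection : CovariantDerivative I E (TangentSpace I : M → Type _) :=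
  D.exists_isMetricHypersurfaceConnection.choose

theorem connection_spec : D.IsMetricHypersurfaceConnection D.connection :=
  D.exists_isMetricHypersurfaceConnection.choose_spec

/-- Null metric hypersurface data: `n⁽²⁾` vanishes everywhere. -/
def IsNull : Prop := ∀ x, D.n₂ x = 0

/-- The function `tr_P U`. -/
def trU (x : M) : ℝ := D.contractP x (D.U x)

end MetricHypersurfaceData

/-- Hypersurface data: metric hypersurface data with a smooth symmetric 2-covariant tensor `Y`. -/
structure HypersurfaceData (I : ModelWithCorners ℝ E H) (M : Type*) [TopologicalSpace M]
    [ChartedSpace H M] [IsManifold I ∞ M] extends MetricHypersurfaceData I M where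
  Y : ∀ x : M, TangentSpace I x →L[ℝ] TangentSpace I x →L[ℝ] ℝ
  Y_symm : ∀ (x : M) (v w : TangentSpace I x), Y x v w = Y x w v
  Y_smooth : ContMDiff I (I.prod 𝓘(ℝ, E →L[ℝ] E →L[ℝ] ℝ)) ∞
    (fun x ↦ TotalSpace.mk' (E →L[ℝ] E →L[ℝ] ℝ) x (Y x))

namespace HypersurfaceData

variable (D : HypersurfaceData I M)

/-- The covector `r = Y(n, ·)`. -/
def r (x : M) (w : TangentSpace I x) : ℝ := D.Y x (D.n x) w

/-- The function `κ_n = -Y(n, n)`. -/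
def κ (x : M) : ℝ := -D.Y x (D.n x) (D.n x)

/-- The constraint tensor `𝓡` of null hypersurface data, at tangent vectors `v`, `w`:
`𝓡_{ab} = R°_{(ab)} - 2 £_n Y_{ab} - (2 κ_n + tr_P U) Y_{ab} + ∇°_{(a} (s_{b)} + 2 r_{b)})`
`- 2 r_a r_b + 4 r_{(a} s_{b)} - s_a s_b - (tr_P Y) U_{ab} + 2 P^{cd} U_{d(a} (2 Y_{b)c} + F_{b)c})`,
where round brackets denote symmetrization with the factor `1/2`. -/
def constraintTensor (x : M) (v w : TangentSpace I x) : ℝ :=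
  1 / 2 * (ricci D.connection x v w + ricci D.connection x w v)
    - 2 * lieDerivTwo D.n (fun y v w ↦ D.Y y v w) x v w
    - (2 * D.κ x + D.trU x) * D.Y x v w
    + 1 / 2 * (covDerivOne D.connection (fun y z ↦ D.s y z + 2 * D.r y z) x v w
      + covDerivOne D.connection (fun y z ↦ D.s y z + 2 * D.r y z) x w v)
    - 2 * D.r x v * D.r x w
    + 2 * (D.r x v * D.s x w + D.r x w * D.s x v)
    - D.s x v * D.s x w
    - D.contractP x (fun c d ↦ D.Y x c d) * D.U x v w
    + D.contractP x (fun c d ↦ D.U x d v * (2 * D.Y x w c + D.F x w c)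
      + D.U x d w * (2 * D.Y x v c + D.F x v c))

end HypersurfaceData

end Data

end

/-! ### Calculus of vector fields on a manifold: smoothness and brackets. -/

section Calculus

variable {E : Type*} [NormedAddCommGroup E] [NormedSpace ℝ E]
  {H : Type*} [TopologicalSpace H] {I : ModelWithCorners ℝ E H}
  {M : Type*} [TopologicalSpace M] [ChartedSpace H M] [IsManifold I ∞ M]
  {x : M} {X Y Z W : ∀ x : M, TangentSpace I x} {f g : M → ℝ}

/-! For null data γ(n, ·) = 0 and ℓ(n) = 1. Differentiating these two identities with the metric
hypersurface connection shows that the endomorphism ∇n encodes both U and s: γ(∇_v n, w) = U(v, w)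
and ℓ(∇_v n) = s(v) (`IsNull.γ_cov_n`, `IsNull.ℓ_cov_n`). In particular ∇_n n = 0. Since P is
inverse to γ up to n ⊗ ℓ, contractions with P become ordinary traces and evaluations
(`IsNull.contractP_γ`, `IsNull.contractP_mul_ℓ`, `IsNull.contractP_mul_U`); for example tr_P U is
the divergence of n. One more derivative turns P^{cd} ∇_c U_{wd} into the trace of the second
covariant derivative ∇²_{·, w} n, up to terms in s (`IsNull.contractP_covDerivTwo_U`).

The same trace occurs in the Ricci tensor: the contracted Ricci identity gives Ric(n, w) = tr ∇²_{·,
w} n - w(div n) (`ricci_apply_field`). The constraint tensor contains only the symmetric part of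
Ric, so the antisymmetric part is needed too. By the first Bianchi identity it is half the trace of
the curvature endomorphism (`ricci_sub_ricci`). That trace equals the exterior derivative of s
(`IsNull.trace_curvatureEnd`), by contracting with P the Ricci identity for γ and inserting the
curvature acting on n.

Writing Lie derivatives through the torsion-free connection and using r(n) = -κ_n, s(n) = 0, U(n, ·)
= 0, both sides of the first formula become combinations of the same scalars: derivatives of κ_n and
tr_P U, ∇_n r, ∇_n s, r and s at w and ∇_w n, and tr ∇²n. The second formula follows by putting w =
n, with (∇_c U)(n, d) = -U(c, ∇_d n) and (£_n (r - s))(n) = -n(κ_n).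

Tensors at a point are evaluated on arbitrary local extensions of vectors. Replacing the extension
of n(x) by the field n itself rests on tensoriality, which in turn needs the connection to preserve
smoothness of vector fields. -/

lemma ContMDiffAt.mdiffAt_of_infty {F : Type*} [NormedAddCommGroup F] [NormedSpace ℝ F]
    {H' : Type*} [TopologicalSpace H'] {J : ModelWithCorners ℝ F H'}
    {M' : Type*} [TopologicalSpace M'] [ChartedSpace H' M'] {f : M → M'}
    (hf : ContMDiffAt I J ∞ f x) : MDifferentiableAt I J f x :=
  hf.mdifferentiableAt (by simp)

/-- Being C^∞ at a point gives, for each finite order, a neighbourhood that may depend on the order;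
hence the passage through C^1, whose neighbourhood suffices. -/
lemma ContMDiffAt.eventually_mdiffAt {F : Type*} [NormedAddCommGroup F] [NormedSpace ℝ F]
    {H' : Type*} [TopologicalSpace H'] {J : ModelWithCorners ℝ F H'}
    {M' : Type*} [TopologicalSpace M'] [ChartedSpace H' M'] [IsManifold J ∞ M'] {f : M → M'}
    (hf : ContMDiffAt I J ∞ f x) : ∀ᶠ y in nhds x, MDifferentiableAt I J f y := by
  have : IsManifold J 1 M' := IsManifold.of_le (n := ∞) (by simp)
  have : IsManifold I 1 M := IsManifold.of_le (n := ∞) (by simp)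
  have h1 : ContMDiffAt I J 1 f x := hf.of_le (by simp)
  filter_upwards [(contMDiffAt_iff_contMDiffAt_nhds (by simp)).1 h1] with y hy
  exact hy.mdifferentiableAt (by simp)

lemma eventually_mdiffAt_section (hX : CMDiffAt ∞ (T% X) x) :
    ∀ᶠ y in nhds x, MDiffAt (T% X) y :=
  hX.eventually_mdiffAt

lemma mvfderiv_congr (h : f =ᶠ[nhds x] g) : d% f x = d% g x := by
  rw [mvfderiv, mvfderiv, h.mfderiv_eq, h.eq_of_nhds]

lemma contMDiffAt_mvfderiv_apply (hf : CMDiffAt ∞ f x) (hX : CMDiffAt ∞ (T% X) x) :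
    CMDiffAt ∞ (fun y ↦ d% f y (X y)) x := by
  have h1 := hf.mfderiv_const (m := ∞) (by simp)
  have h2 : ContMDiffAt I 𝓘(ℝ).tangent ∞
      (fun y ↦ (⟨f y, mfderiv% f y (X y)⟩ : TangentBundle 𝓘(ℝ) ℝ)) x := by
    rw [← contMDiffWithinAt_univ]
    exact ContMDiffWithinAt.clm_apply_of_inCoordinates h1.contMDiffWithinAt
      hX.contMDiffWithinAt hf.contMDiffWithinAt
  exact (contMDiff_snd_tangentBundle_modelSpace ℝ 𝓘(ℝ)).contMDiffAt.comp x h2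

lemma isManifold_minSmoothness_two : IsManifold I (minSmoothness ℝ 2) M :=
  IsManifold.of_le (n := ∞) (by simpa using (WithTop.coe_le_coe.2 le_top : (2 : ℕ∞ω) ≤ ∞))

lemma contMDiffAt_mlieBracket [CompleteSpace E] (hX : CMDiffAt ∞ (T% X) x)
    (hY : CMDiffAt ∞ (T% Y) x) : CMDiffAt ∞ (T% (mlieBracket I X Y)) x :=
  have : IsManifold I (minSmoothness ℝ 2) M := isManifold_minSmoothness_two
  have : IsManifold I ((⊤ : ℕ∞) + 1) M := inferInstanceAs (IsManifold I ∞ M)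
  ContMDiffAt.mlieBracket_vectorField (m := ⊤) (n := ⊤) hX hY (by simp)

lemma mlieBracket_congr_right (h : ∀ᶠ y in nhds x, Y y = Z y) :
    mlieBracket I X Y x = mlieBracket I X Z x :=
  Filter.EventuallyEq.mlieBracket_vectorField_eq (Filter.EventuallyEq.refl _ _) h

/-- The commutator of the derivations defined by two vector fields is their Lie bracket. -/
lemma mvfderiv_mlieBracket [CompleteSpace E] (hf : CMDiffAt ∞ f x) (hX : CMDiffAt ∞ (T% X) x)
    (hY : CMDiffAt ∞ (T% Y) x) :
    d% f x (mlieBracket I X Y x)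
      = d% (fun y ↦ d% f y (Y y)) x (X x) - d% (fun y ↦ d% f y (X y)) x (Y x) := by
  -- The argument below reads off the coefficient of a nonzero tangent vector, so a trivial tangent
  -- space is treated apart.
  rcases subsingleton_or_nontrivial (TangentSpace I x) with hs | hs
  · rw [Subsingleton.elim (mlieBracket I X Y x) 0, Subsingleton.elim (X x) 0,
      Subsingleton.elim (Y x) 0]
    simp
  obtain ⟨z, hz⟩ := exists_ne (0 : TangentSpace I x)
  set Z : ∀ y : M, TangentSpace I y := extend E z with hZdef
  have hZ : CMDiffAt ∞ (T% Z) x := contMDiffAt_extend ..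
  have hZx : Z x = z := by simp [Z]
  have key {V : ∀ x : M, TangentSpace I x} (hV : CMDiffAt ∞ (T% V) x) :
      ∀ᶠ y in nhds x, mlieBracket I V (f • Z) y
        = ((fun y ↦ d% f y (V y)) • Z + f • mlieBracket I V Z) y := by
    filter_upwards [hf.eventually_mdiffAt, eventually_mdiffAt_section hZ] with y hy hy'
    rw [mlieBracket_smul_right hy hy']
    rfl
  have step {V V' : ∀ x : M, TangentSpace I x} (hV : CMDiffAt ∞ (T% V) x)
      (hV' : CMDiffAt ∞ (T% V') x) :
      mlieBracket I V (mlieBracket I V' (f • Z)) x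
        = d% (fun y ↦ d% f y (V' y)) x (V x) • z + d% f x (V' x) • mlieBracket I V Z x
          + (d% f x (V x) • mlieBracket I V' Z x
            + f x • mlieBracket I V (mlieBracket I V' Z) x) := by
    have h1 := contMDiffAt_mvfderiv_apply hf hV'
    have h2 := contMDiffAt_mlieBracket hV' hZ
    rw [mlieBracket_congr_right (key hV'),
      mlieBracket_add_right (h1.smul_section hZ).mdiffAt_of_infty
        (hf.smul_section h2).mdiffAt_of_infty,
      mlieBracket_smul_right h1.mdiffAt_of_infty hZ.mdiffAt_of_infty,
      mlieBracket_smul_right hf.mdiffAt_of_infty h2.mdiffAt_of_infty, hZx]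
  have h2 {V : ∀ x : M, TangentSpace I x} (hV : CMDiffAt ∞ (T% V) x) :
      CMDiffAt (minSmoothness ℝ 2) (T% V) x := hV.of_le (by
    simpa using (WithTop.coe_le_coe.2 le_top : (2 : ℕ∞ω) ≤ ∞))
  have : IsManifold I (minSmoothness ℝ 3) M :=
    IsManifold.of_le (n := ∞) (by
    simpa using (WithTop.coe_le_coe.2 le_top : (3 : ℕ∞ω) ≤ ∞))
  -- The Jacobi identity for fZ minus f times the one for Z leaves ([X, Y]f - X(Yf) + Y(Xf)) Z = 0,
  -- the cross terms cancelling in pairs.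
  have j1 := leibniz_identity_mlieBracket_apply (h2 hX) (h2 hY) (h2 (hf.smul_section hZ))
  have j2 := leibniz_identity_mlieBracket_apply (h2 hX) (h2 hY) (h2 hZ)
  rw [step hX hY, step hY hX, mlieBracket_smul_right hf.mdiffAt_of_infty hZ.mdiffAt_of_infty,
    hZx, j2] at j1
  have j3 : (d% f x (mlieBracket I X Y x)
      - (d% (fun y ↦ d% f y (Y y)) x (X x) - d% (fun y ↦ d% f y (X y)) x (Y x))) • z = 0 := by
    linear_combination (norm := module) (-1 : ℝ) • j1
  exact sub_eq_zero.1 ((smul_eq_zero.1 j3).resolve_right hz)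

/-! ### Covariant derivatives: locality and linearity. -/

section Connection

variable (cov : CovariantDerivative I E (TangentSpace I : M → Type _))

/-- Covariant differentiation maps smooth vector fields to smooth vector fields. -/
def PreservesSmooth : Prop :=
  ∀ ⦃x : M⦄ ⦃Z X : ∀ x : M, TangentSpace I x⦄, CMDiffAt ∞ (T% Z) x → CMDiffAt ∞ (T% X) x →
    CMDiffAt ∞ (T% (fun y ↦ cov Z y (X y))) x

variable {cov}

lemma cov_congr (hZ : MDiffAt (T% Z) x) (hW : MDiffAt (T% W) x) (h : ∀ᶠ y in nhds x, Z y = W y) :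
    cov Z x = cov W x :=
  cov.isCovariantDerivativeOnUniv.congr_of_eventuallyEq hZ hW Filter.univ_mem h

lemma cov_add (hZ : MDiffAt (T% Z) x) (hW : MDiffAt (T% W) x) :
    cov (Z + W) x = cov Z x + cov W x :=
  cov.isCovariantDerivativeOnUniv.add hZ hW

lemma cov_smul (hf : MDiffAt f x) (hZ : MDiffAt (T% Z) x) :
    cov (f • Z) x = f x • cov Z x + (d% f x).smulRight (Z x) :=
  cov.isCovariantDerivativeOnUniv.leibniz hZ hf

lemma cov_sub (hZ : MDiffAt (T% Z) x) (hW : MDiffAt (T% W) x) :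
    cov (Z - W) x = cov Z x - cov W x := by
  have h1 : MDiffAt (T% ((fun _ : M ↦ (-1 : ℝ)) • W)) x :=
    (mdifferentiableAt_const (c := (-1 : ℝ))).smul_section hW
  have : Z - W = Z + (fun _ : M ↦ (-1 : ℝ)) • W := by
    ext y
    simp [sub_eq_add_neg]
  rw [this, cov_add hZ h1, cov_smul mdifferentiableAt_const hW, mvfderiv_const]
  ext v
  simp [sub_eq_add_neg]

lemma cov_sum {ι : Type*} {s : Finset ι} {σ : ι → ∀ x : M, TangentSpace I x}
    (hσ : ∀ i ∈ s, MDiffAt (T% (σ i)) x) :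
    cov (fun y ↦ ∑ i ∈ s, σ i y) x = ∑ i ∈ s, cov (σ i) x := by
  classical
  induction s using Finset.induction_on with
  | empty => exact (congrFun cov.zero x).trans (by simp)
  | insert a s ha h =>
      simp only [Finset.mem_insert, forall_eq_or_imp] at hσ
      simp only [Finset.sum_insert ha, ← h hσ.2]
      exact cov_add hσ.1 (.sum_section hσ.2)

end Connection

end Calculus

/-! ### Curvature: tensoriality in the differentiated field and the first Bianchi identity. -/

section Curvature

variable {E : Type*} [NormedAddCommGroup E] [NormedSpace ℝ E] [FiniteDimensional ℝ E]
  {H : Type*} [TopologicalSpace H] {I : ModelWithCorners ℝ E H}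
  {M : Type*} [TopologicalSpace M] [ChartedSpace H M] [IsManifold I ∞ M]
  {x : M} {X Y Z W : ∀ x : M, TangentSpace I x} {f g : M → ℝ}
  {cov : CovariantDerivative I E (TangentSpace I : M → Type _)}

lemma cov_torsionFree (ht : cov.torsion = 0) (hX : MDiffAt (T% X) x)
    (hW : MDiffAt (T% W) x) : mlieBracket I X W x = cov W x (X x) - cov X x (W x) :=
  (cov.torsion_eq_zero_iff.1 ht hX hW).symm

lemma curvatureField_swap (X W Z : ∀ x : M, TangentSpace I x) (x : M) :
    curvatureField cov X W Z x = -curvatureField cov W X Z x := by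
  simp only [curvatureField]
  rw [mlieBracket_swap_apply, map_neg]
  abel

/-- Only the germ of the field matters: equality near x gives equality of the first covariant
derivatives near x, which can then be differentiated again. -/
lemma curvatureField_congr (hP : PreservesSmooth cov) (hX : CMDiffAt ∞ (T% X) x)
    (hW : CMDiffAt ∞ (T% W) x) (hZ : CMDiffAt ∞ (T% Z) x) (hY : CMDiffAt ∞ (T% Y) x)
    (h : ∀ᶠ y in nhds x, Z y = Y y) :
    curvatureField cov X W Z x = curvatureField cov X W Y x := by
  have h1 : ∀ᶠ y in nhds x, cov Z y = cov Y y := by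
    filter_upwards [h.eventually_nhds, eventually_mdiffAt_section hZ,
      eventually_mdiffAt_section hY] with y h1 h2 h3
    exact cov_congr h2 h3 h1
  simp only [curvatureField]
  rw [h1.self_of_nhds, cov_congr (hP hZ hW).mdiffAt_of_infty (hP hY hW).mdiffAt_of_infty
    (h1.mono fun y hy ↦ by simp only [hy]),
    cov_congr (hP hZ hX).mdiffAt_of_infty (hP hY hX).mdiffAt_of_infty
    (h1.mono fun y hy ↦ by simp only [hy])]

lemma curvatureField_add (hP : PreservesSmooth cov) (hX : CMDiffAt ∞ (T% X) x)
    (hW : CMDiffAt ∞ (T% W) x) (hZ : CMDiffAt ∞ (T% Z) x) (hY : CMDiffAt ∞ (T% Y) x) :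
    curvatureField cov X W (Z + Y) x
      = curvatureField cov X W Z x + curvatureField cov X W Y x := by
  have h1 : ∀ᶠ y in nhds x, cov (Z + Y) y = cov Z y + cov Y y := by
    filter_upwards [eventually_mdiffAt_section hZ, eventually_mdiffAt_section hY] with y h2 h3
    exact cov_add h2 h3
  have h2 {V : ∀ x : M, TangentSpace I x} (hV : CMDiffAt ∞ (T% V) x) :
      cov (fun y ↦ cov (Z + Y) y (V y)) x
        = cov (fun y ↦ cov Z y (V y)) x + cov (fun y ↦ cov Y y (V y)) x := by
    rw [← cov_add (hP hZ hV).mdiffAt_of_infty (hP hY hV).mdiffAt_of_infty]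
    refine cov_congr (hP (hZ.add_section hY) hV).mdiffAt_of_infty
      ((hP hZ hV).add_section (hP hY hV)).mdiffAt_of_infty (h1.mono fun y hy ↦ ?_)
    simp [hy]
  simp only [curvatureField]
  rw [h1.self_of_nhds, h2 hX, h2 hW]
  simp only [add_apply]
  abel

/-- First derivatives of f cancel by antisymmetry in X and W, and the second derivatives combine
into X(Wf) - W(Xf) - [X, W]f = 0. -/
lemma curvatureField_smul (hP : PreservesSmooth cov)
    (hX : CMDiffAt ∞ (T% X) x) (hW : CMDiffAt ∞ (T% W) x) (hZ : CMDiffAt ∞ (T% Z) x)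
    (hf : CMDiffAt ∞ f x) :
    curvatureField cov X W (f • Z) x = f x • curvatureField cov X W Z x := by
  have h2 {V : ∀ x : M, TangentSpace I x} (hV : CMDiffAt ∞ (T% V) x) (v : TangentSpace I x) :
      cov (fun y ↦ cov (f • Z) y (V y)) x v
        = f x • cov (fun y ↦ cov Z y (V y)) x v + d% f x v • cov Z x (V x)
          + (d% f x (V x) • cov Z x v + d% (fun y ↦ d% f y (V y)) x v • Z x) := by
    have h3 : ∀ᶠ y in nhds x, cov (f • Z) y (V y)
        = (f • (fun y ↦ cov Z y (V y)) + (fun y ↦ d% f y (V y)) • Z) y := by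
      filter_upwards [eventually_mdiffAt_section hZ, hf.eventually_mdiffAt] with y h2 h3
      rw [cov_smul h3 h2]
      simp
    have s1 := hf.smul_section (hP hZ hV)
    have s2 := (contMDiffAt_mvfderiv_apply hf hV).smul_section hZ
    rw [cov_congr (hP (hf.smul_section hZ) hV).mdiffAt_of_infty
      (s1.add_section s2).mdiffAt_of_infty h3, cov_add s1.mdiffAt_of_infty s2.mdiffAt_of_infty,
      cov_smul hf.mdiffAt_of_infty (hP hZ hV).mdiffAt_of_infty,
      cov_smul (contMDiffAt_mvfderiv_apply hf hV).mdiffAt_of_infty hZ.mdiffAt_of_infty]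
    simp
  simp only [curvatureField]
  rw [h2 hX, h2 hW, cov_smul hf.mdiffAt_of_infty hZ.mdiffAt_of_infty]
  simp only [add_apply, smul_apply, ContinuousLinearMap.smulRight_apply]
  rw [mvfderiv_mlieBracket hf hX hW]
  module

/-- The first Bianchi identity. -/
lemma curvatureField_bianchi (ht : cov.torsion = 0) (hP : PreservesSmooth cov)
    (hX : CMDiffAt ∞ (T% X) x) (hW : CMDiffAt ∞ (T% W) x) (hZ : CMDiffAt ∞ (T% Z) x) :
    curvatureField cov X W Z x + curvatureField cov W Z X x + curvatureField cov Z X W x = 0 := by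
  have h2 {V : ∀ x : M, TangentSpace I x} (hV : CMDiffAt ∞ (T% V) x) :
      CMDiffAt (minSmoothness ℝ 2) (T% V) x := hV.of_le (by
    simpa using (WithTop.coe_le_coe.2 le_top : (2 : ℕ∞ω) ≤ ∞))
  have : IsManifold I (minSmoothness ℝ 3) M :=
    IsManifold.of_le (n := ∞) (by
    simpa using (WithTop.coe_le_coe.2 le_top : (3 : ℕ∞ω) ≤ ∞))
  have key {X W Z : ∀ x : M, TangentSpace I x} (hX : CMDiffAt ∞ (T% X) x)
      (hW : CMDiffAt ∞ (T% W) x) (hZ : CMDiffAt ∞ (T% Z) x) :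
      mlieBracket I X (mlieBracket I W Z) x
        = cov (fun y ↦ cov Z y (W y)) x (X x) - cov (fun y ↦ cov W y (Z y)) x (X x)
          - cov X x (mlieBracket I W Z x) := by
    rw [cov_torsionFree ht hX.mdiffAt_of_infty (contMDiffAt_mlieBracket hW hZ).mdiffAt_of_infty]
    congr 1
    rw [cov_congr (W := (fun y ↦ cov Z y (W y)) - (fun y ↦ cov W y (Z y)))
      (contMDiffAt_mlieBracket hW hZ).mdiffAt_of_infty
      ((mdifferentiableAt_sub_section (hP hZ hW).mdiffAt_of_infty
        (hP hW hZ).mdiffAt_of_infty)),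
      cov_sub (hP hZ hW).mdiffAt_of_infty (hP hW hZ).mdiffAt_of_infty]
    · rfl
    · filter_upwards [eventually_mdiffAt_section hZ, eventually_mdiffAt_section hW] with y h1 h2
      exact cov_torsionFree ht h2 h1
  have j := leibniz_identity_mlieBracket_apply (h2 hX) (h2 hW) (h2 hZ)
  rw [mlieBracket_swap_apply (V := mlieBracket I X W), key hX hW hZ, key hZ hX hW, key hW hX hZ,
    mlieBracket_swap_apply (V := X) (W := Z), map_neg] at j
  simp only [curvatureField]
  linear_combination (norm := module) (1 : ℝ) • j

end Curvature

/-! ### Local frames, traces and the Ricci tensor. -/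

section Frame

variable {E : Type*} [NormedAddCommGroup E] [NormedSpace ℝ E] [FiniteDimensional ℝ E]
  {H : Type*} [TopologicalSpace H] {I : ModelWithCorners ℝ E H}
  {M : Type*} [TopologicalSpace M] [ChartedSpace H M] [IsManifold I ∞ M]
  {x : M} {X Y Z W : ∀ x : M, TangentSpace I x} {f g : M → ℝ}
  {cov : CovariantDerivative I E (TangentSpace I : M → Type _)}
  {ι : Type*} [Fintype ι] (b : Module.Basis ι ℝ (TangentSpace I x))

/-- Near `x`, the extensions of a basis of `T_x M` form a basis of the tangent space. -/
lemma eventually_exists_basis_extend :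
    ∀ᶠ y in nhds x, ∃ B : Module.Basis ι ℝ (TangentSpace I y), ∀ i, B i = extend E (b i) y := by
  let t := trivializationAt E (TangentSpace I : M → Type _) x
  have hx : x ∈ t.baseSet := FiberBundle.mem_baseSet_trivializationAt' x
  filter_upwards [t.open_baseSet.mem_nhds hx] with y hy
  -- `extend` keeps a vector constant in the trivialization at x, so the frame at y is the given
  -- basis transported through that trivialization.
  refine ⟨(b.map (t.linearEquivAt (R := ℝ) x hx)).map (t.linearEquivAt (R := ℝ) y hy).symm,
    fun i ↦ ?_⟩
  simp only [Module.Basis.map_apply]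
  rfl

/-- A smooth vector field has smooth coefficients in the frame extending a basis of `T_x M`. -/
lemma exists_coeff_extend (hZ : CMDiffAt ∞ (T% Z) x) :
    ∃ c : ι → M → ℝ, (∀ i, CMDiffAt ∞ (c i) x) ∧
      ∀ᶠ y in nhds x, Z y = ∑ i, c i y • extend E (b i) y := by
  let t := trivializationAt E (TangentSpace I : M → Type _) x
  have hx : x ∈ t.baseSet := FiberBundle.mem_baseSet_trivializationAt' x
  let b' := b.map (t.linearEquivAt (R := ℝ) x hx)
  refine ⟨fun i y ↦ t.localFrameCoeff I b' i y (Z y), fun i ↦ contMDiffAt_localFrameCoeff b' hx hZ i,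
    ?_⟩
  filter_upwards [t.eventually_eq_localFrame_sum_coeff_smul b' (s := Z) (I := I) hx,
    t.open_baseSet.mem_nhds hx] with y h1 hy
  rw [h1]
  refine Finset.sum_congr rfl fun i _ ↦ ?_
  rw [← h1]
  congr 1
  rw [t.localFrame_apply_of_mem_baseSet b' hy]
  rfl

lemma contMDiffAt_sum_section {σ : ι → ∀ x : M, TangentSpace I x} (s : Finset ι)
    (hσ : ∀ i, CMDiffAt ∞ (T% (σ i)) x) : CMDiffAt ∞ (T% (fun y ↦ ∑ i ∈ s, σ i y)) x :=
  ContMDiffAt.sum_section fun i _ ↦ hσ i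

lemma curvatureField_sum (hP : PreservesSmooth cov) (hX : CMDiffAt ∞ (T% X) x)
    (hW : CMDiffAt ∞ (T% W) x) {σ : ι → ∀ x : M, TangentSpace I x}
    (hσ : ∀ i, CMDiffAt ∞ (T% (σ i)) x) (s : Finset ι) :
    curvatureField cov X W (fun y ↦ ∑ i ∈ s, σ i y) x
      = ∑ i ∈ s, curvatureField cov X W (σ i) x := by
  classical
  induction s using Finset.induction_on with
  | empty =>
      -- The empty sum is the zero field, treated as the function 0 times a smooth field.
      have := curvatureField_smul hP hX hW (f := fun _ ↦ 0)
        (contMDiffAt_extend (k := ∞) I E (0 : TangentSpace I x)) contMDiffAt_const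
      simp only [zero_smul] at this
      rw [Finset.sum_empty, ← this]
      congr 1
      ext y
      simp
  | insert a s ha h =>
      simp only [Finset.sum_insert ha, ← h]
      exact curvatureField_add hP hX hW (hσ a) (contMDiffAt_sum_section s hσ)

/-- The right side sees Z only through its value at x, so this is pointwise dependence on Z; it
makes `curvatureEnd` the curvature on every smooth field. -/
lemma curvatureField_eq_sum (hP : PreservesSmooth cov) (hX : CMDiffAt ∞ (T% X) x)
    (hW : CMDiffAt ∞ (T% W) x) (hZ : CMDiffAt ∞ (T% Z) x) :
    curvatureField cov X W Z x
      = ∑ i, b.repr (Z x) i • curvatureField cov X W (extend E (b i)) x := by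
  obtain ⟨c, hc, hcZ⟩ := exists_coeff_extend b hZ
  have he (i) : CMDiffAt ∞ (T% (extend E (b i))) x := contMDiffAt_extend ..
  have hs (i) : CMDiffAt ∞ (T% (c i • extend E (b i))) x := (hc i).smul_section (he i)
  have hZx : ∀ i, b.repr (Z x) i = c i x := fun i ↦ by
    classical
    rw [hcZ.self_of_nhds]
    simp [Finsupp.single_apply]
  rw [curvatureField_congr hP hX hW hZ (contMDiffAt_sum_section Finset.univ hs) hcZ,
    curvatureField_sum hP hX hW hs]
  exact Finset.sum_congr rfl fun i _ ↦ by rw [curvatureField_smul hP hX hW (he i) (hc i), hZx]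

/-- The curvature `R(X, W)` at `x` as an endomorphism of `T_x M`. -/
noncomputable def curvatureEnd (cov : CovariantDerivative I E (TangentSpace I : M → Type _))
    (X W : ∀ x : M, TangentSpace I x) (x : M) : TangentSpace I x →ₗ[ℝ] TangentSpace I x :=
  (Module.finBasis ℝ (TangentSpace I x)).constr ℝ
    fun i ↦ curvatureField cov X W (extend E (Module.finBasis ℝ (TangentSpace I x) i)) x

lemma curvatureEnd_apply (hP : PreservesSmooth cov) (hX : CMDiffAt ∞ (T% X) x)
    (hW : CMDiffAt ∞ (T% W) x) (hZ : CMDiffAt ∞ (T% Z) x) :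
    curvatureEnd cov X W x (Z x) = curvatureField cov X W Z x := by
  rw [curvatureField_eq_sum (Module.finBasis ℝ (TangentSpace I x)) hP hX hW hZ, curvatureEnd,
    Module.Basis.constr_apply_fintype]
  rfl

lemma sum_coord_eq_trace {V : Type*} [AddCommGroup V] [Module ℝ V] {ι : Type*} [Fintype ι]
    (b : Module.Basis ι ℝ V) (A : V →ₗ[ℝ] V) : ∑ i, b.coord i (A (b i)) = LinearMap.trace ℝ V A := by
  classical
  rw [LinearMap.trace_eq_matrix_trace ℝ b, Matrix.trace]
  simp [LinearMap.toMatrix_apply]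

/-- The derivative of the trace of a field of endomorphisms is the trace of its covariant
derivative. -/
lemma mvfderiv_trace {A : ∀ y : M, TangentSpace I y →ₗ[ℝ] TangentSpace I y}
    (hA : ∀ i, CMDiffAt ∞ (T% (fun y ↦ A y (extend E (b i) y))) x) (w : TangentSpace I x) :
    d% (fun y ↦ LinearMap.trace ℝ (TangentSpace I y) (A y)) x w
      = ∑ i, b.coord i (cov (fun y ↦ A y (extend E (b i) y)) x w
        - A x (cov (extend E (b i)) x w)) := by
  choose c hc hcA using fun i ↦ exists_coeff_extend b (hA i)
  have hcA' : ∀ᶠ y in nhds x, ∀ i, A y (extend E (b i) y) = ∑ j, c i j y • extend E (b j) y :=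
    Filter.eventually_all.2 hcA
  -- The extended basis is still a basis near x, so the trace is the sum of the diagonal
  -- coefficients on a neighbourhood and can be differentiated termwise.
  have htr : (fun y ↦ LinearMap.trace ℝ (TangentSpace I y) (A y)) =ᶠ[nhds x]
      fun y ↦ ∑ i, c i i y := by
    filter_upwards [hcA', eventually_exists_basis_extend b] with y h1 ⟨B, hB⟩
    rw [← sum_coord_eq_trace B]
    refine Finset.sum_congr rfl fun i _ ↦ ?_
    classical
    rw [hB, h1]
    simp [← hB, Finsupp.single_apply]
  have he (i) : CMDiffAt ∞ (T% (extend E (b i))) x := contMDiffAt_extend ..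
  have hs (i j) : CMDiffAt ∞ (T% (c i j • extend E (b j))) x := (hc i j).smul_section (he j)
  have hcov (i) : cov (fun y ↦ A y (extend E (b i) y)) x w
      = ∑ j, (c i j x • cov (extend E (b j)) x w + d% (c i j) x w • b j) := by
    have h2 : cov (fun y ↦ A y (extend E (b i) y)) x
        = cov (fun y ↦ ∑ j, (c i j • extend E (b j)) y) x :=
      cov_congr (hA i).mdiffAt_of_infty
        (contMDiffAt_sum_section Finset.univ (hs i)).mdiffAt_of_infty (hcA i)
    rw [h2, cov_sum fun j _ ↦ (hs i j).mdiffAt_of_infty]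
    simp only [sum_apply]
    refine Finset.sum_congr rfl fun j _ ↦ ?_
    rw [cov_smul (hc i j).mdiffAt_of_infty (he j).mdiffAt_of_infty]
    simp
  have hAx (i) : A x (b i) = ∑ j, c i j x • b j := by
    simpa using hcA'.self_of_nhds i
  have hAv (v : TangentSpace I x) : A x v = ∑ j, b.repr v j • ∑ k, c j k x • b k := by
    conv_lhs => rw [← b.sum_repr v, map_sum]
    simp only [map_smul, hAx]
  have hd : d% (fun y ↦ ∑ i, c i i y) x w = ∑ i, d% (c i i) x w := by
    have h (s : Finset ι) : d% (fun y ↦ ∑ i ∈ s, c i i y) x w = ∑ i ∈ s, d% (c i i) x w := by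
      classical
      induction s using Finset.induction_on with
      | empty => simp [mvfderiv_const]
      | insert a s ha h =>
          simp only [Finset.sum_insert ha, ← h]
          rw [mvfderiv_fun_add (hc a a).mdiffAt_of_infty
            (ContMDiffAt.sum fun i _ ↦ hc i i).mdiffAt_of_infty]
          rfl
    exact h _
  rw [mvfderiv_congr htr, hd]
  simp only [hcov, hAv]
  simp only [map_sub, map_sum, map_add, map_smul, smul_eq_mul, Module.Basis.coord_apply,
    Module.Basis.repr_self]
  classical
  simp only [Finsupp.single_apply, mul_ite, mul_one, mul_zero, Finset.sum_ite_eq',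
    Finset.mem_univ, if_true, Finset.sum_add_distrib, Finset.sum_sub_distrib]
  -- After exchanging the summation indices, the connection terms of ∇(A e_i) and of A(∇ e_i) are
  -- the same double sum and cancel.
  rw [Finset.sum_comm (f := fun i j ↦ b.repr (cov (extend E (b i)) x w) j * c j i x)]
  simp only [mul_comm]
  ring

/-- Bianchi in each summand: R(e, w)z - R(e, z)w = R(z, w)e. -/
lemma ricci_sub_ricci (ht : cov.torsion = 0) (hP : PreservesSmooth cov) (x : M)
    (z w : TangentSpace I x) :
    ricci cov x z w - ricci cov x w z
      = LinearMap.trace ℝ _ (curvatureEnd cov (extend E z) (extend E w) x) := by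
  rw [← sum_coord_eq_trace (Module.finBasis ℝ (TangentSpace I x)), ricci, ricci,
    ← Finset.sum_sub_distrib]
  refine Finset.sum_congr rfl fun i _ ↦ ?_
  rw [← map_sub]
  congr 1
  set e := Module.finBasis ℝ (TangentSpace I x) i
  have he (v : TangentSpace I x) : CMDiffAt ∞ (T% (extend E v)) x := contMDiffAt_extend ..
  have h := curvatureField_bianchi ht hP (he e) (he w) (he z)
  have h2 := curvatureEnd_apply hP (he z) (he w) (he e)
  rw [extend_apply_self] at h2
  rw [h2, curvatureField_swap (extend E z) (extend E w),
    curvatureField_swap (extend E e) (extend E z)]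
  linear_combination (norm := module) (1 : ℝ) • h

/-- The second covariant derivative `v ↦ ∇²_{v, W} Z` of a vector field at `x`. -/
noncomputable def secondCov (cov : CovariantDerivative I E (TangentSpace I : M → Type _))
    (Z W : ∀ x : M, TangentSpace I x) (x : M) : TangentSpace I x →L[ℝ] TangentSpace I x :=
  cov (fun y ↦ cov Z y (W y)) x - (cov Z x).comp (cov W x)

/-- Without torsion, [X, W] = ∇_X W - ∇_W X, and these are exactly the corrections that make the two
second derivatives tensorial. -/
lemma curvatureField_eq_secondCov (ht : cov.torsion = 0) (hX : CMDiffAt ∞ (T% X) x)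
    (hW : CMDiffAt ∞ (T% W) x) :
    curvatureField cov X W Z x = secondCov cov Z W x (X x) - secondCov cov Z X x (W x) := by
  simp only [curvatureField, secondCov]
  rw [cov_torsionFree ht hX.mdiffAt_of_infty hW.mdiffAt_of_infty]
  simp
  abel

/-- The contracted Ricci identity. -/
lemma ricci_apply_field (ht : cov.torsion = 0) (hP : PreservesSmooth cov)
    (hZ : CMDiffAt ∞ (T% Z) x) (w : TangentSpace I x) :
    ricci cov x (Z x) w = LinearMap.trace ℝ (TangentSpace I x) (secondCov cov Z (extend E w) x)
      - d% (fun y ↦ LinearMap.trace ℝ (TangentSpace I y) (cov Z y)) x w := by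
  have he (v : TangentSpace I x) : CMDiffAt ∞ (T% (extend E v)) x := contMDiffAt_extend ..
  rw [mvfderiv_trace (cov := cov) (Module.finBasis ℝ (TangentSpace I x))
    (A := fun y ↦ (cov Z y : TangentSpace I y →ₗ[ℝ] TangentSpace I y)) (fun i ↦ hP hZ (he _)),
    ← sum_coord_eq_trace (Module.finBasis ℝ (TangentSpace I x)), ricci, ← Finset.sum_sub_distrib]
  refine Finset.sum_congr rfl fun i _ ↦ ?_
  -- `ricci` extends the vector Z x arbitrarily; passing through the curvature endomorphism replaces
  -- that extension by Z.
  have h2 := curvatureEnd_apply hP (he (Module.finBasis ℝ (TangentSpace I x) i)) (he w)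
    (he (Z x))
  rw [← map_sub, ← h2, extend_apply_self, curvatureEnd_apply hP (he _) (he w) hZ,
    curvatureField_eq_secondCov ht (he _) (he w)]
  simp [secondCov]

end Frame

/-! ### Smoothness of the metric hypersurface connection. -/

section SmoothConnection

variable {E : Type*} [NormedAddCommGroup E] [NormedSpace ℝ E] [FiniteDimensional ℝ E]
  {H : Type*} [TopologicalSpace H] {I : ModelWithCorners ℝ E H}
  {M : Type*} [TopologicalSpace M] [ChartedSpace H M] [IsManifold I ∞ M]

/-- Cramer's rule: the solution of a smooth family of non-degenerate linear systems is smooth. -/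
lemma contMDiffAt_of_solves_smooth {W : Type*} [NormedAddCommGroup W] [NormedSpace ℝ W]
    [FiniteDimensional ℝ W] {k : ℕ∞ω} {x : M} {A : M → LinearMap.BilinForm ℝ W}
    (hA : ∀ u v, CMDiffAt k (fun y ↦ A y u v) x) (hx : (A x).Nondegenerate)
    {w : M → W} {f : M → W → ℝ} (hf : ∀ v, CMDiffAt k (fun y ↦ f y v) x)
    (hw : ∀ᶠ y in nhds x, ∀ v, A y v (w y) = f y v) :
    CMDiffAt k w x := by
  classical
  let b := Module.finBasis ℝ W
  let G (y : M) : Matrix _ _ ℝ := Matrix.of fun i j ↦ A y (b i) (b j)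
  have hG (i j) : CMDiffAt k (fun y ↦ G y i j) x := hA (b i) (b j)
  have hdet := MetricHypersurfaceData.contMDiffAt_det hG
  have hne : (G x).det ≠ 0 := by
    have h := (LinearMap.BilinForm.nondegenerate_iff_det_ne_zero b).1 hx
    have h' : LinearMap.BilinForm.toMatrix b (A x) = G x := by
      ext i j
      simp [G, LinearMap.BilinForm.toMatrix_apply]
    rwa [h'] at h
  have hev : ∀ᶠ y in nhds x, (G y).det ≠ 0 := hdet.continuousAt.eventually_ne hne
  have key : w =ᶠ[nhds x] fun y ↦ ∑ i, ((G y).det⁻¹ *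
      ((G y).updateCol i (fun j ↦ f y (b j))).det) • b i := by
    filter_upwards [hw, hev] with y hy hy'
    have h1 : (G y).mulVec (b.repr (w y)) = fun j ↦ f y (b j) := by
      ext j
      rw [← hy (b j)]
      conv_rhs => rw [← b.sum_repr (w y)]
      simp only [G, Matrix.mulVec, dotProduct, Matrix.of_apply, map_sum, map_smul, smul_eq_mul]
      exact Finset.sum_congr rfl fun i _ ↦ mul_comm _ _
    have h2 (i) : b.repr (w y) i = (G y).det⁻¹ *
      ((G y).updateCol i (fun j ↦ f y (b j))).det := by
      rw [← Matrix.cramer_apply, ← h1, Matrix.cramer_eq_adjugate_mulVec, Matrix.mulVec_mulVec,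
        Matrix.adjugate_mul, Matrix.smul_mulVec, Matrix.one_mulVec]
      simp [hy']
    simp_rw [← h2]
    exact (b.sum_repr (w y)).symm
  refine ContMDiffAt.congr_of_eventuallyEq (ContMDiffAt.sum fun i _ ↦ ?_) key
  have h : CMDiffAt k (fun y ↦ ((G y).updateCol i (fun j ↦ f y (b j))).det) x := by
    apply MetricHypersurfaceData.contMDiffAt_det
    intro i' j
    by_cases h : j = i
    · subst h; simpa using hf (b i')
    · simpa [Matrix.updateCol_ne h] using hG i' j
  exact ((hdet.inv₀ hne).mul h).smul contMDiffAt_const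

namespace MetricHypersurfaceData

variable (D : MetricHypersurfaceData I M) {x : M} {X Z W V : ∀ x : M, TangentSpace I x}
  {cov : CovariantDerivative I E (TangentSpace I : M → Type _)}

/-- A vector field is smooth if its contractions with the metric hypersurface data are. -/
lemma contMDiffAt_of_contractions
    (hγ : ∀ W : ∀ x : M, TangentSpace I x, CMDiffAt ∞ (T% W) x →
      CMDiffAt ∞ (fun y ↦ D.γ y (V y) (W y)) x)
    (hℓ : CMDiffAt ∞ (fun y ↦ D.ℓ y (V y)) x) : CMDiffAt ∞ (T% V) x := by
  let t := trivializationAt E (TangentSpace I : M → Type _) x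
  have hx : x ∈ t.baseSet := FiberBundle.mem_baseSet_trivializationAt' x
  have hS (v : E) : CMDiffAt ∞ (T% (fun y ↦ t.symmL ℝ y v)) x := by
    rw [contMDiffAt_section]
    refine (contMDiffAt_const (c := v)).congr_of_eventuallyEq ?_
    filter_upwards [t.open_baseSet.mem_nhds hx] with y hy
    change (t ⟨y, t.symmL ℝ y v⟩).2 = v
    rw [t.symmL_apply hy, t.apply_mk_symm hy]
  let A (y : M) : LinearMap.BilinForm ℝ (E × ℝ) :=
    (ambientForm (D.γ y) (D.ℓ y) (D.ℓ₂ y)).compl₁₂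
      ((t.symmL ℝ y : E →ₗ[ℝ] TangentSpace I y).prodMap LinearMap.id)
      ((t.symmL ℝ y : E →ₗ[ℝ] TangentSpace I y).prodMap LinearMap.id)
  have hA (u v : E × ℝ) : CMDiffAt ∞ (fun y ↦ A y u v) x := by
    simp only [A, ambientForm, LinearMap.compl₁₂_apply, LinearMap.mk₂_apply,
      LinearMap.prodMap_apply]
    have h1 := contMDiffAt_apply₂ (D.γ_smooth x) (hS u.1) (hS v.1)
    have h2 (w : E) := contMDiffAt_apply₁ (D.ℓ_smooth x) (hS w)
    have h3 (c : ℝ) : CMDiffAt ∞ (fun _ : M ↦ c) x := contMDiffAt_const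
    exact ((h1.add ((h3 u.2).mul (h2 v.1))).add ((h3 v.2).mul (h2 u.1))).add
      ((h3 (u.2 * v.2)).mul (D.ℓ₂_smooth x))
  have hnd : (A x).Nondegenerate := by
    let e : (E × ℝ) ≃ₗ[ℝ] TangentSpace I x × ℝ :=
      (t.continuousLinearEquivAt ℝ x hx).symm.toLinearEquiv.prodCongr (LinearEquiv.refl ℝ ℝ)
    have h := (D.nondegenerate x).congr e.symm
    have he (u : E × ℝ) : e u = (t.symmL ℝ x u.1, u.2) :=
      Prod.ext (t.symmL_apply hx u.1).symm rfl
    have hAe : A x = LinearMap.BilinForm.congr e.symm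
        (ambientForm (D.γ x) (D.ℓ x) (D.ℓ₂ x)) := by
      refine LinearMap.ext₂ fun u v ↦ ?_
      rw [LinearMap.BilinForm.congr_apply, LinearEquiv.symm_symm, he, he]
      rfl
    rwa [hAe]
  -- The pair (V, 0) solves the linear system of 𝒜 whose right side consists of the contractions of
  -- V assumed smooth.
  have hsol : ∀ᶠ y in nhds x, ∀ v, A y v ((t ⟨y, V y⟩).2, 0)
      = D.γ y (V y) (t.symmL ℝ y v.1) + v.2 * D.ℓ y (V y) := by
    filter_upwards [t.open_baseSet.mem_nhds hx] with y hy v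
    have h3 : t.symmL ℝ y (t ⟨y, V y⟩).2 = V y := by
      rw [t.symmL_apply hy, t.symm_apply_apply_mk hy]
    simp only [A, ambientForm, LinearMap.compl₁₂_apply, LinearMap.mk₂_apply,
      LinearMap.prodMap_apply, LinearMap.id_apply, ContinuousLinearMap.coe_coe, h3]
    rw [D.γ_symm]
    ring
  have hf (v : E × ℝ) : CMDiffAt ∞
      (fun y ↦ D.γ y (V y) (t.symmL ℝ y v.1) + v.2 * D.ℓ y (V y)) x :=
    (hγ _ (hS v.1)).add (contMDiffAt_const.mul hℓ)
  rw [contMDiffAt_section]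
  exact contDiff_fst.contMDiff.contMDiffAt.comp x (contMDiffAt_of_solves_smooth hA hnd hf hsol)

lemma contMDiffAt_n : CMDiffAt ∞ (T% D.n) x := (D.n_smooth_aux x).1

lemma contMDiffAt_γ (hX : CMDiffAt ∞ (T% X) x) (hZ : CMDiffAt ∞ (T% Z) x) :
    CMDiffAt ∞ (fun y ↦ D.γ y (X y) (Z y)) x := contMDiffAt_apply₂ (D.γ_smooth x) hX hZ

lemma contMDiffAt_ℓ (hX : CMDiffAt ∞ (T% X) x) :
    CMDiffAt ∞ (fun y ↦ D.ℓ y (X y)) x := contMDiffAt_apply₁ (D.ℓ_smooth x) hX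

lemma contMDiffAt_U (hX : CMDiffAt ∞ (T% X) x) (hZ : CMDiffAt ∞ (T% Z) x) :
    CMDiffAt ∞ (fun y ↦ D.U y (X y) (Z y)) x := by
  have h2 := (D.n_smooth_aux x).2
  -- The definition of U uses extensions that change with the point; tensoriality exchanges them for
  -- the fixed fields X and Z, whose expression is visibly smooth.
  have h : (fun y ↦ D.U y (X y) (Z y)) =ᶠ[nhds x] fun y ↦ 1 / 2 * D.lieγ y X Z
      + 1 / 2 * (D.ℓ y (X y) * d% D.n₂ y (Z y) + D.ℓ y (Z y) * d% D.n₂ y (X y)) := by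
    filter_upwards [eventually_mdiffAt_section hX, eventually_mdiffAt_section hZ] with y h1 h2
    exact D.U_apply h1 h2
  refine ContMDiffAt.congr_of_eventuallyEq ?_ h
  have h3 : CMDiffAt ∞ (fun y ↦ D.lieγ y X Z) x :=
    ((contMDiffAt_mvfderiv_apply (D.contMDiffAt_γ hX hZ) D.contMDiffAt_n).sub
      (D.contMDiffAt_γ (contMDiffAt_mlieBracket D.contMDiffAt_n hX) hZ)).sub
      (D.contMDiffAt_γ hX (contMDiffAt_mlieBracket D.contMDiffAt_n hZ))
  exact (contMDiffAt_const.mul h3).add (contMDiffAt_const.mul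
    (((D.contMDiffAt_ℓ hX).mul (contMDiffAt_mvfderiv_apply h2 hZ)).add
      ((D.contMDiffAt_ℓ hZ).mul (contMDiffAt_mvfderiv_apply h2 hX))))

lemma contMDiffAt_F (hX : CMDiffAt ∞ (T% X) x) (hZ : CMDiffAt ∞ (T% Z) x) :
    CMDiffAt ∞ (fun y ↦ D.F y (X y) (Z y)) x := by
  have h : (fun y ↦ D.F y (X y) (Z y)) =ᶠ[nhds x] fun y ↦ 1 / 2 * D.dℓ y X Z := by
    filter_upwards [eventually_mdiffAt_section hX, eventually_mdiffAt_section hZ] with y h1 h2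
    exact D.F_apply h1 h2
  refine ContMDiffAt.congr_of_eventuallyEq ?_ h
  exact contMDiffAt_const.mul
    (((contMDiffAt_mvfderiv_apply (D.contMDiffAt_ℓ hZ) hX).sub
      (contMDiffAt_mvfderiv_apply (D.contMDiffAt_ℓ hX) hZ)).sub
      (D.contMDiffAt_ℓ (contMDiffAt_mlieBracket hX hZ)))

variable {D}

/-- The Koszul computation: ∇γ for three arrangements of the fields, combined with vanishing
torsion. -/
lemma IsMetricHypersurfaceConnection.γ_cov (h : D.IsMetricHypersurfaceConnection cov)
    (hZ : MDiffAt (T% Z) x) (hX : MDiffAt (T% X) x) (hW : MDiffAt (T% W) x) :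
    D.γ x (cov Z x (X x)) (W x) = D.koszul x Z X W := by
  have ht {X Y : ∀ x : M, TangentSpace I x} (hX : MDiffAt (T% X) x) (hY : MDiffAt (T% Y) x) :
      cov Y x (X x) - cov X x (Y x) = mlieBracket I X Y x :=
    cov.torsion_eq_zero_iff.1 h.torsion_eq_zero hX hY
  have a1 := h.covDeriv_γ x X Z W hX hZ hW
  have a2 := h.covDeriv_γ x Z X W hZ hX hW
  have a3 := h.covDeriv_γ x W X Z hW hX hZ
  have t1 := congrArg (fun v ↦ D.γ x v (W x)) (ht hX hZ)
  have t2 := congrArg (fun v ↦ D.γ x v (Z x)) (ht hX hW)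
  have t3 := congrArg (fun v ↦ D.γ x v (X x)) (ht hZ hW)
  rw [D.U_symm x (Z x) (X x)] at a2
  rw [D.U_symm x (W x) (X x), D.U_symm x (W x) (Z x)] at a3
  simp only [covDerivTwoField, D.γ_symm x (Z x), D.γ_symm x (X x), map_sub, sub_apply]
    at a1 a2 a3 t1 t2 t3
  rw [koszul]
  linear_combination (-1 / 2) * a1 - (1 / 2) * a2 + (1 / 2) * a3 + (1 / 2) * t1
    - (1 / 2) * t2 - (1 / 2) * t3

/-- The symmetric part of ∇ℓ is prescribed, and its antisymmetric part is F because there is no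
torsion. -/
lemma IsMetricHypersurfaceConnection.ℓ_cov (h : D.IsMetricHypersurfaceConnection cov)
    (hZ : MDiffAt (T% Z) x) (v : TangentSpace I x) :
    D.ℓ x (cov Z x v) = D.transv x Z v := by
  have hv := mdifferentiableAt_extend I E v
  have a1 := h.covDeriv_ℓ x (extend E v) Z hv hZ
  have t1 := congrArg (D.ℓ x) (cov_torsionFree h.torsion_eq_zero hv hZ)
  have hF := D.F_apply hv hZ
  simp only [covDerivOneField, map_sub, extend_apply_self, dℓ] at a1 t1 hF
  rw [transv]
  linear_combination (-1 / 2) * a1 - (1 / 2) * t1 + hF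

/-- The contractions of ∇_X Z with γ and ℓ have explicit smooth formulas, and by non-degeneracy of 𝒜
they determine the field smoothly. -/
lemma IsMetricHypersurfaceConnection.preservesSmooth (h : D.IsMetricHypersurfaceConnection cov) :
    PreservesSmooth cov := by
  intro x Z X hZ hX
  have hU := D.contMDiffAt_U hX hZ
  refine D.contMDiffAt_of_contractions (fun W hW ↦ ?_) ?_
  · have he : (fun y ↦ D.γ y (cov Z y (X y)) (W y)) =ᶠ[nhds x] fun y ↦ D.koszul y Z X W := by
      filter_upwards [eventually_mdiffAt_section hX, eventually_mdiffAt_section hZ,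
        eventually_mdiffAt_section hW] with y h1 h2 h3
      exact h.γ_cov h2 h1 h3
    refine ContMDiffAt.congr_of_eventuallyEq ?_ he
    have hd {A B C : ∀ x : M, TangentSpace I x} (hA : CMDiffAt ∞ (T% A) x)
        (hB : CMDiffAt ∞ (T% B) x) (hC : CMDiffAt ∞ (T% C) x) :=
      contMDiffAt_mvfderiv_apply (D.contMDiffAt_γ hA hB) hC
    have hb {A B C : ∀ x : M, TangentSpace I x} (hA : CMDiffAt ∞ (T% A) x)
        (hB : CMDiffAt ∞ (T% B) x) (hC : CMDiffAt ∞ (T% C) x) :=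
      D.contMDiffAt_γ (contMDiffAt_mlieBracket hA hB) hC
    exact (contMDiffAt_const.mul ((((((hd hZ hW hX).add (hd hX hW hZ)).sub (hd hX hZ hW)).add
      (hb hX hZ hW)).sub (hb hX hW hZ)).sub (hb hZ hW hX))).add
      (hU.mul (D.contMDiffAt_ℓ hW))
  · have he : (fun y ↦ D.ℓ y (cov Z y (X y))) =ᶠ[nhds x] fun y ↦ D.transv y Z (X y) := by
      filter_upwards [eventually_mdiffAt_section hZ] with y h1
      exact h.ℓ_cov h1 _
    refine ContMDiffAt.congr_of_eventuallyEq ?_ he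
    exact ((contMDiffAt_mvfderiv_apply (D.contMDiffAt_ℓ hZ) hX).sub
      (D.contMDiffAt_F hX hZ)).add ((D.ℓ₂_smooth x).mul hU)

lemma IsMetricHypersurfaceConnection.mvfderiv_γ (h : D.IsMetricHypersurfaceConnection cov)
    (hZ : MDiffAt (T% Z) x) (hW : MDiffAt (T% W) x) (v : TangentSpace I x) :
    d% (fun y ↦ D.γ y (Z y) (W y)) x v
      = D.γ x (cov Z x v) (W x) + D.γ x (Z x) (cov W x v)
        - D.U x v (Z x) * D.ℓ x (W x) - D.U x v (W x) * D.ℓ x (Z x) := by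
  have a := h.covDeriv_γ x (extend E v) Z W (mdifferentiableAt_extend I E v) hZ hW
  simp only [covDerivTwoField, extend_apply_self] at a
  linear_combination a

/-- In tensor form: ∇ℓ = F - ℓ⁽²⁾ U. -/
lemma IsMetricHypersurfaceConnection.mvfderiv_ℓ (h : D.IsMetricHypersurfaceConnection cov)
    (hZ : MDiffAt (T% Z) x) (v : TangentSpace I x) :
    d% (fun y ↦ D.ℓ y (Z y)) x v
      = D.ℓ x (cov Z x v) + D.F x v (Z x) - D.ℓ₂ x * D.U x v (Z x) := by
  rw [h.ℓ_cov hZ, transv]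
  ring

end MetricHypersurfaceData

end SmoothConnection

/-! ### Null data: contractions with P and the first derivative of n. -/

section Contraction

namespace MetricHypersurfaceData

variable {E : Type*} [NormedAddCommGroup E] [NormedSpace ℝ E] [FiniteDimensional ℝ E]
  {H : Type*} [TopologicalSpace H] {I : ModelWithCorners ℝ E H}
  {M : Type*} [TopologicalSpace M] [ChartedSpace H M] [IsManifold I ∞ M]
  (D : MetricHypersurfaceData I M) {x : M} {X Z W V : ∀ x : M, TangentSpace I x}
  {cov : CovariantDerivative I E (TangentSpace I : M → Type _)}

lemma P_comm (x : M) (α β : Module.Dual ℝ (TangentSpace I x)) : D.P x α β = D.P x β α := by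
  obtain ⟨a1, a2⟩ := D.sharp_spec x α 0
  obtain ⟨b1, b2⟩ := D.sharp_spec x β 0
  simp only [P, inverseForm, zero_mul, add_zero]
  rw [← a1, ← b1, D.γ_symm]
  linear_combination (D.sharp x β 0).2 * a2 - (D.sharp x α 0).2 * b2

lemma contractP_swap (x : M) (T : TangentSpace I x → TangentSpace I x → ℝ) :
    D.contractP x (fun c d ↦ T d c) = D.contractP x T := by
  simp only [contractP]
  rw [Finset.sum_comm]
  simp_rw [D.P_comm x]

lemma contractP_add (x : M) (S T : TangentSpace I x → TangentSpace I x → ℝ) :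
    D.contractP x (fun c d ↦ S c d + T c d) = D.contractP x S + D.contractP x T := by
  simp only [contractP, mul_add, Finset.sum_add_distrib]

lemma contractP_sub (x : M) (S T : TangentSpace I x → TangentSpace I x → ℝ) :
    D.contractP x (fun c d ↦ S c d - T c d) = D.contractP x S - D.contractP x T := by
  simp only [contractP, mul_sub, Finset.sum_sub_distrib]

lemma contractP_mul_left (x : M) (a : ℝ) (T : TangentSpace I x → TangentSpace I x → ℝ) :
    D.contractP x (fun c d ↦ a * T c d) = a * D.contractP x T := by
  simp only [contractP, Finset.mul_sum]
  exact Finset.sum_congr rfl fun i _ ↦ Finset.sum_congr rfl fun j _ ↦ by ring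

/-- P raises an index: P(α, ·) is the vector part of `sharp` at (α, 0), so one of the two sums can
be carried out. -/
lemma contractP_eq_sum (x : M) (T : TangentSpace I x → TangentSpace I x →ₗ[ℝ] ℝ) :
    D.contractP x (fun c d ↦ T c d) = ∑ i, T (Module.finBasis ℝ (TangentSpace I x) i)
      (D.sharp x ((Module.finBasis ℝ (TangentSpace I x)).coord i) 0).1 := by
  refine Finset.sum_congr rfl fun i _ ↦ ?_
  conv_rhs => rw [← (Module.finBasis ℝ (TangentSpace I x)).sum_repr (D.sharp x _ 0).1, map_sum]
  refine Finset.sum_congr rfl fun j _ ↦ ?_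
  simp [P, inverseForm]

variable {D} (hD : D.IsNull)
include hD

lemma IsNull.γ_n_left (x : M) (w : TangentSpace I x) : D.γ x (D.n x) w = 0 := by
  rw [D.γ_n, hD]
  simp

lemma IsNull.γ_n_right (x : M) (w : TangentSpace I x) : D.γ x w (D.n x) = 0 := by
  rw [D.γ_symm, hD.γ_n_left]

lemma IsNull.ℓ_n (x : M) : D.ℓ x (D.n x) = 1 := by
  rw [D.ℓ_n, hD]
  simp

lemma IsNull.sharp_snd (x : M) (α : Module.Dual ℝ (TangentSpace I x)) :
    (D.sharp x α 0).2 = α (D.n x) := by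
  have h := (D.sharp_spec x α 0).1 (D.n x)
  rw [hD.γ_n_right, hD.ℓ_n] at h
  linarith

/-- In indices, P^{ac} γ_{cb} = δ^a_b - n^a ℓ_b. -/
lemma IsNull.contractP_γ (x : M) (B : TangentSpace I x →ₗ[ℝ] TangentSpace I x) :
    D.contractP x (fun c d ↦ D.γ x (B c) d)
      = LinearMap.trace ℝ _ B - D.ℓ x (B (D.n x)) := by
  have h := D.contractP_eq_sum x (fun c ↦ (D.γ x (B c) : TangentSpace I x →ₗ[ℝ] ℝ))
  simp only [ContinuousLinearMap.coe_coe] at h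
  rw [h]
  set b := Module.finBasis ℝ (TangentSpace I x)
  have h1 (i) : D.γ x (B (b i)) (D.sharp x (b.coord i) 0).1
      = b.coord i (B (b i)) - b.coord i (D.n x) * D.ℓ x (B (b i)) := by
    have := (D.sharp_spec x (b.coord i) 0).1 (B (b i))
    rw [hD.sharp_snd] at this
    rw [D.γ_symm]
    linarith
  rw [Finset.sum_congr rfl fun i _ ↦ h1 i, Finset.sum_sub_distrib, sum_coord_eq_trace]
  congr 1
  conv_rhs => rw [← b.sum_repr (D.n x), map_sum, map_sum]
  simp only [map_smul, smul_eq_mul, Module.Basis.coord_apply]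

/-- In indices, P^{ab} ℓ_b = -ℓ⁽²⁾ n^a. -/
lemma IsNull.contractP_mul_ℓ (x : M) (θ : TangentSpace I x →ₗ[ℝ] ℝ) :
    D.contractP x (fun c d ↦ θ c * D.ℓ x d) = -D.ℓ₂ x * θ (D.n x) := by
  have h := D.contractP_eq_sum x (fun c ↦ θ c • (D.ℓ x : TangentSpace I x →ₗ[ℝ] ℝ))
  simp only [LinearMap.smul_apply, ContinuousLinearMap.coe_coe, smul_eq_mul] at h
  rw [h]
  set b := Module.finBasis ℝ (TangentSpace I x)
  conv_rhs => rw [← b.sum_repr (D.n x), map_sum, Finset.mul_sum]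
  refine Finset.sum_congr rfl fun i _ ↦ ?_
  have := (D.sharp_spec x (b.coord i) 0).2
  rw [hD.sharp_snd] at this
  simp only [map_smul, smul_eq_mul, Module.Basis.coord_apply] at this ⊢
  linear_combination θ (b i) * this

lemma IsNull.mvfderiv_n₂ (x : M) : d% D.n₂ x = 0 := by
  have : D.n₂ = fun _ ↦ 0 := funext hD
  rw [this, mvfderiv_const]

/-- Every term of £_n γ(n, ·) contains γ(n, ·) or [n, n], and dn⁽²⁾ vanishes. -/
lemma IsNull.U_n_left (x : M) (w : TangentSpace I x) : D.U x (D.n x) w = 0 := by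
  have h := D.U_apply D.mdiff_n (mdifferentiableAt_extend I E w)
  simp only [extend_apply_self] at h
  rw [h, hD.mvfderiv_n₂]
  simp [lieγ, hD.γ_n_left, mvfderiv_const]

lemma IsNull.U_n_right (x : M) (w : TangentSpace I x) : D.U x w (D.n x) = 0 := by
  rw [D.U_symm, hD.U_n_left]

omit hD in
lemma F_antisymm (x : M) (v w : TangentSpace I x) : D.F x v w = -D.F x w v := by
  have h := D.dℓ_swap x (extend E v) (extend E w)
  have h1 := D.F_apply (mdifferentiableAt_extend I E v) (mdifferentiableAt_extend I E w)
  have h2 := D.F_apply (mdifferentiableAt_extend I E w) (mdifferentiableAt_extend I E v)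
  simp only [extend_apply_self] at h1 h2
  rw [h1, h2, h]
  ring

omit hD in
lemma s_n (x : M) : D.s x (D.n x) = 0 := by
  have := F_antisymm (D := D) x (D.n x) (D.n x)
  rw [s]
  linarith

/-- Differentiate γ(n, W) = 0; in ∇γ only the term U(v, W) ℓ(n) survives. -/
lemma IsNull.γ_cov_n (h : D.IsMetricHypersurfaceConnection cov) (x : M)
    (v w : TangentSpace I x) : D.γ x (cov D.n x v) w = D.U x v w := by
  have h1 := h.mvfderiv_γ D.mdiff_n (mdifferentiableAt_extend I E w) v
  simp only [hD.γ_n_left, mvfderiv_const, hD.U_n_right, hD.ℓ_n, extend_apply_self] at h1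
  simp at h1
  linarith

/-- Differentiate ℓ(n) = 1, using U(·, n) = 0 and F(v, n) = -s(v). -/
lemma IsNull.ℓ_cov_n (h : D.IsMetricHypersurfaceConnection cov) (x : M)
    (v : TangentSpace I x) : D.ℓ x (cov D.n x v) = D.s x v := by
  have h1 := h.mvfderiv_ℓ D.mdiff_n v
  simp only [hD.ℓ_n, mvfderiv_const, hD.U_n_right] at h1
  rw [F_antisymm] at h1
  simp at h1
  rw [s]
  linarith

lemma IsNull.cov_n_n (h : D.IsMetricHypersurfaceConnection cov) (x : M) :
    cov D.n x (D.n x) = 0 :=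
  D.ext_of_apply (fun w ↦ by simp [hD.γ_cov_n h, hD.U_n_left])
    (by simp [hD.ℓ_cov_n h, s_n])

/-- Apply `IsNull.contractP_γ` to the rank-one endomorphism θ ⊗ ∇_w n, since U(·, w) = γ(∇_w n, ·).
-/
lemma IsNull.contractP_mul_U (h : D.IsMetricHypersurfaceConnection cov) (x : M)
    (θ : TangentSpace I x →ₗ[ℝ] ℝ) (w : TangentSpace I x) :
    D.contractP x (fun c d ↦ θ c * D.U x d w)
      = θ (cov D.n x w) - D.s x w * θ (D.n x) := by
  have h1 := hD.contractP_γ x (θ.smulRight (cov D.n x w))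
  simp only [LinearMap.smulRight_apply, map_smul, smul_apply, smul_eq_mul,
    hD.γ_cov_n h, hD.ℓ_cov_n h, LinearMap.trace_smulRight] at h1
  simp only [D.U_symm x _ w]
  rw [h1]
  ring

/-- The correction term ℓ(∇_n n) in the trace formula is s(n) = 0. -/
lemma IsNull.trU_eq_trace (h : D.IsMetricHypersurfaceConnection cov) :
    D.trU = fun y ↦ LinearMap.trace ℝ (TangentSpace I y) (cov D.n y) := by
  ext y
  have h1 := hD.contractP_γ y (cov D.n y : TangentSpace I y →ₗ[ℝ] TangentSpace I y)
  simp only [ContinuousLinearMap.coe_coe, hD.γ_cov_n h, hD.ℓ_cov_n h, s_n, sub_zero] at h1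
  exact h1

end MetricHypersurfaceData

end Contraction

/-! ### Second derivatives of n and the trace of the curvature. -/

section SecondOrder

variable {E : Type*} [NormedAddCommGroup E] [NormedSpace ℝ E] [FiniteDimensional ℝ E]
  {H : Type*} [TopologicalSpace H] {I : ModelWithCorners ℝ E H}
  {M : Type*} [TopologicalSpace M] [ChartedSpace H M] [IsManifold I ∞ M]
  {x : M} {X Z W V : ∀ x : M, TangentSpace I x}
  {cov : CovariantDerivative I E (TangentSpace I : M → Type _)}

/-- Expand Z in a smooth frame: by the Leibniz rule the derivatives of the coefficients appear in
both terms of ∇θ and cancel. -/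
lemma covDerivOneField_eq_sum {ι : Type*} [Fintype ι] (b : Module.Basis ι ℝ (TangentSpace I x))
    {θ : ∀ x : M, TangentSpace I x →ₗ[ℝ] ℝ}
    (hθ : ∀ Z : ∀ x : M, TangentSpace I x, CMDiffAt ∞ (T% Z) x → CMDiffAt ∞ (fun y ↦ θ y (Z y)) x)
    (hZ : CMDiffAt ∞ (T% Z) x) (u : TangentSpace I x) :
    covDerivOneField cov (fun y v ↦ θ y v) Z x u
      = ∑ i, b.repr (Z x) i * covDerivOneField cov (fun y v ↦ θ y v) (extend E (b i)) x u := by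
  classical
  obtain ⟨c, hc, hcZ⟩ := exists_coeff_extend b hZ
  have he (i) : CMDiffAt ∞ (T% (extend E (b i))) x := contMDiffAt_extend ..
  have hs (i) : CMDiffAt ∞ (T% (c i • extend E (b i))) x := (hc i).smul_section (he i)
  have hZx : ∀ i, b.repr (Z x) i = c i x := fun i ↦ by
    rw [hcZ.self_of_nhds]
    simp [Finsupp.single_apply]
  have hθs (i) : CMDiffAt ∞ (fun y ↦ c i y * θ y (extend E (b i) y)) x :=
    (hc i).mul (hθ _ (he i))
  have h1 : (fun y ↦ θ y (Z y)) =ᶠ[nhds x] fun y ↦ ∑ i, c i y * θ y (extend E (b i) y) :=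
    hcZ.mono fun y hy ↦ by simp [hy]
  have h2 (s : Finset ι) : d% (fun y ↦ ∑ i ∈ s, c i y * θ y (extend E (b i) y)) x u
      = ∑ i ∈ s, (c i x * d% (fun y ↦ θ y (extend E (b i) y)) x u
        + θ x (b i) * d% (c i) x u) := by
    induction s using Finset.induction_on with
    | empty => simp [mvfderiv_const]
    | insert a s ha h =>
        simp only [Finset.sum_insert ha, ← h]
        rw [mvfderiv_fun_add (hθs a).mdiffAt_of_infty
          (ContMDiffAt.sum fun i _ ↦ hθs i).mdiffAt_of_infty,
          mvfderiv_fun_mul (hc a).mdiffAt_of_infty (hθ _ (he a)).mdiffAt_of_infty]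
        simp
  have h3 : cov Z x u = ∑ i, (c i x • cov (extend E (b i)) x u + d% (c i) x u • b i) := by
    have h : cov Z x = cov (fun y ↦ ∑ i, (c i • extend E (b i)) y) x :=
      cov_congr hZ.mdiffAt_of_infty (contMDiffAt_sum_section Finset.univ hs).mdiffAt_of_infty hcZ
    rw [h, cov_sum fun j _ ↦ (hs j).mdiffAt_of_infty]
    simp only [sum_apply]
    refine Finset.sum_congr rfl fun j _ ↦ ?_
    rw [cov_smul (hc j).mdiffAt_of_infty (he j).mdiffAt_of_infty]
    simp
  simp only [covDerivOneField]
  rw [mvfderiv_congr h1, h2, h3, map_sum, ← Finset.sum_sub_distrib]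
  refine Finset.sum_congr rfl fun i _ ↦ ?_
  rw [hZx]
  simp only [map_add, map_smul, smul_eq_mul]
  ring

/-- The covariant derivative of a smooth covector field is tensorial. -/
lemma covDerivOneField_congr {θ : ∀ x : M, TangentSpace I x →ₗ[ℝ] ℝ}
    (hθ : ∀ Z : ∀ x : M, TangentSpace I x, CMDiffAt ∞ (T% Z) x → CMDiffAt ∞ (fun y ↦ θ y (Z y)) x)
    (hZ : CMDiffAt ∞ (T% Z) x) (hW : CMDiffAt ∞ (T% W) x) (h : Z x = W x)
    (u : TangentSpace I x) :
    covDerivOneField cov (fun y v ↦ θ y v) Z x u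
      = covDerivOneField cov (fun y v ↦ θ y v) W x u := by
  rw [covDerivOneField_eq_sum (Module.finBasis ℝ _) hθ hZ,
    covDerivOneField_eq_sum (Module.finBasis ℝ _) hθ hW, h]

namespace MetricHypersurfaceData

variable {D : MetricHypersurfaceData I M}

variable (D) in
/-- The covector `s` as a linear form. -/
noncomputable def sLinear (x : M) : TangentSpace I x →ₗ[ℝ] ℝ := ((D.exists_F x).choose (D.n x) : _ →ₗ[ℝ] ℝ)

lemma sLinear_apply (x : M) (w : TangentSpace I x) : D.sLinear x w = D.s x w :=
  ((D.exists_F x).choose_spec (D.n x) w).symm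

variable (hD : D.IsNull) (h : D.IsMetricHypersurfaceConnection cov)
include hD h

lemma IsNull.contMDiffAt_s (hZ : CMDiffAt ∞ (T% Z) x) :
    CMDiffAt ∞ (fun y ↦ D.s y (Z y)) x := by
  simp only [← hD.ℓ_cov_n h]
  exact D.contMDiffAt_ℓ (h.preservesSmooth D.contMDiffAt_n hZ)

/-- Obtained by differentiating U(W, Z) = γ(∇_W n, Z); the last two terms come from ∇γ. -/
lemma IsNull.covDerivTwoField_U (hW : CMDiffAt ∞ (T% W) x) (hZ : CMDiffAt ∞ (T% Z) x)
    (v : TangentSpace I x) :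
    covDerivTwoField cov D.U W Z x v = D.γ x (secondCov cov D.n W x v) (Z x)
      - D.U x v (cov D.n x (W x)) * D.ℓ x (Z x) - D.U x v (Z x) * D.s x (W x) := by
  have h1 := h.mvfderiv_γ (h.preservesSmooth D.contMDiffAt_n hW).mdiffAt_of_infty
    hZ.mdiffAt_of_infty v
  simp only [hD.γ_cov_n h, hD.ℓ_cov_n h] at h1
  simp only [covDerivTwoField, h1, secondCov, sub_apply, ContinuousLinearMap.comp_apply, map_sub,
    hD.γ_cov_n h]
  ring

/-- Obtained by differentiating s(W) = ℓ(∇_W n); the terms in F and U come from ∇ℓ. -/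
lemma IsNull.ℓ_secondCov (hW : CMDiffAt ∞ (T% W) x) (v : TangentSpace I x) :
    D.ℓ x (secondCov cov D.n W x v) = covDerivOneField cov D.s W x v
      - D.F x v (cov D.n x (W x)) + D.ℓ₂ x * D.U x v (cov D.n x (W x)) := by
  have h1 := h.mvfderiv_ℓ (h.preservesSmooth D.contMDiffAt_n hW).mdiffAt_of_infty v
  simp only [hD.ℓ_cov_n h] at h1
  simp only [covDerivOneField, h1, secondCov, sub_apply, ContinuousLinearMap.comp_apply, map_sub,
    hD.ℓ_cov_n h]
  ring

/-- This trace of ∇²n also appears in the contracted Ricci identity, which is how the derivative of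
U enters the first formula. The contraction of U(·, ∇_w n) ⊗ ℓ drops out since U(·, n) = 0. -/
lemma IsNull.contractP_covDerivTwo_U (x : M) (w : TangentSpace I x) :
    D.contractP x (fun c d ↦ covDerivTwo cov D.U x c w d)
      = LinearMap.trace ℝ (TangentSpace I x) (secondCov cov D.n (extend E w) x)
        - D.ℓ x (secondCov cov D.n (extend E w) x (D.n x)) - D.trU x * D.s x w := by
  obtain ⟨L, hL⟩ := D.exists_U x
  have he (v : TangentSpace I x) : CMDiffAt ∞ (T% (extend E v)) x := contMDiffAt_extend ..
  have h1 := hD.contractP_γ x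
    (secondCov cov D.n (extend E w) x : TangentSpace I x →ₗ[ℝ] TangentSpace I x)
  have h2 := hD.contractP_mul_ℓ x (L (cov D.n x w) : TangentSpace I x →ₗ[ℝ] ℝ)
  simp only [ContinuousLinearMap.coe_coe, ← hL, hD.U_n_right, mul_zero] at h1 h2
  have h3 (c d : TangentSpace I x) : covDerivTwo cov D.U x c w d
      = D.γ x (secondCov cov D.n (extend E w) x c) d - D.U x (cov D.n x w) c * D.ℓ x d
        - D.s x w * D.U x c d := by
    rw [covDerivTwo, hD.covDerivTwoField_U h (he w) (he d), D.U_symm x c (cov D.n x _)]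
    simp only [extend_apply_self]
    ring
  simp only [h3]
  rw [contractP_sub, contractP_sub, h1, h2, contractP_mul_left, trU]
  simp only [sub_zero]
  rw [mul_comm]

/-- The Ricci identity for `γ`. -/
lemma IsNull.ricci_identity_γ (hX : CMDiffAt ∞ (T% X) x) (hW : CMDiffAt ∞ (T% W) x)
    (hZ : CMDiffAt ∞ (T% Z) x) (hV : CMDiffAt ∞ (T% V) x) :
    D.γ x (curvatureField cov X W Z x) (V x) + D.γ x (Z x) (curvatureField cov X W V x)
      = (covDerivTwoField cov D.U W Z x (X x) * D.ℓ x (V x)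
          + D.U x (W x) (Z x) * (D.F x (X x) (V x) - D.ℓ₂ x * D.U x (X x) (V x))
          + covDerivTwoField cov D.U W V x (X x) * D.ℓ x (Z x)
          + D.U x (W x) (V x) * (D.F x (X x) (Z x) - D.ℓ₂ x * D.U x (X x) (Z x)))
        - (covDerivTwoField cov D.U X Z x (W x) * D.ℓ x (V x)
          + D.U x (X x) (Z x) * (D.F x (W x) (V x) - D.ℓ₂ x * D.U x (W x) (V x))
          + covDerivTwoField cov D.U X V x (W x) * D.ℓ x (Z x)
          + D.U x (X x) (V x) * (D.F x (W x) (Z x) - D.ℓ₂ x * D.U x (W x) (Z x))) := by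
  have hP := h.preservesSmooth
  have key {X W : ∀ x : M, TangentSpace I x} (hX : CMDiffAt ∞ (T% X) x)
      (hW : CMDiffAt ∞ (T% W) x) (u : TangentSpace I x) :
      d% (fun y ↦ d% (fun y ↦ D.γ y (Z y) (V y)) y (W y)) x u
        = d% (fun y ↦ D.γ y (cov Z y (W y)) (V y)) x u
          + d% (fun y ↦ D.γ y (Z y) (cov V y (W y))) x u
          - (D.U x (W x) (Z x) * d% (fun y ↦ D.ℓ y (V y)) x u
            + D.ℓ x (V x) * d% (fun y ↦ D.U y (W y) (Z y)) x u)
          - (D.U x (W x) (V x) * d% (fun y ↦ D.ℓ y (Z y)) x u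
            + D.ℓ x (Z x) * d% (fun y ↦ D.U y (W y) (V y)) x u) := by
    have h1 : (fun y ↦ d% (fun y ↦ D.γ y (Z y) (V y)) y (W y)) =ᶠ[nhds x]
        (fun y ↦ D.γ y (cov Z y (W y)) (V y)) + (fun y ↦ D.γ y (Z y) (cov V y (W y)))
          - (fun y ↦ D.U y (W y) (Z y)) * (fun y ↦ D.ℓ y (V y))
          - (fun y ↦ D.U y (W y) (V y)) * (fun y ↦ D.ℓ y (Z y)) := by
      filter_upwards [eventually_mdiffAt_section hZ, eventually_mdiffAt_section hV] with y h1 h2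
      exact h.mvfderiv_γ h1 h2 _
    have a1 := D.contMDiffAt_γ (hP hZ hW) hV
    have a2 := D.contMDiffAt_γ hZ (hP hV hW)
    have b1 := D.contMDiffAt_U hW hZ
    have b2 := D.contMDiffAt_U hW hV
    have c1 := D.contMDiffAt_ℓ hV
    have c2 := D.contMDiffAt_ℓ hZ
    rw [mvfderiv_congr h1, mvfderiv_sub, mvfderiv_sub, mvfderiv_add a1.mdiffAt_of_infty
      a2.mdiffAt_of_infty, mvfderiv_mul b1.mdiffAt_of_infty c1.mdiffAt_of_infty,
      mvfderiv_mul b2.mdiffAt_of_infty c2.mdiffAt_of_infty]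
    · simp
    · exact (a1.add a2).mdiffAt_of_infty
    · exact (b1.mul c1).mdiffAt_of_infty
    · exact ((a1.add a2).sub (b1.mul c1)).mdiffAt_of_infty
    · exact (b2.mul c2).mdiffAt_of_infty
  -- Apply [X, W] = XW - WX to the scalar γ(Z, V). The products of first derivatives cancel, leaving
  -- curvature on one side and derivatives of ∇γ on the other.
  have hg := mvfderiv_mlieBracket (D.contMDiffAt_γ hZ hV) hX hW
  have hZ' := hZ.mdiffAt_of_infty
  have hV' := hV.mdiffAt_of_infty
  obtain ⟨L, hL⟩ := D.exists_U x
  have hLs (v w) : L v w = L w v := by rw [← hL, ← hL, D.U_symm]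
  rw [key hX hW, key hW hX, h.mvfderiv_γ hZ' hV', h.mvfderiv_ℓ hZ', h.mvfderiv_ℓ hV',
    h.mvfderiv_ℓ hZ', h.mvfderiv_ℓ hV',
    h.mvfderiv_γ (hP hZ hW).mdiffAt_of_infty hV', h.mvfderiv_γ (hP hZ hX).mdiffAt_of_infty hV',
    h.mvfderiv_γ hZ' (hP hV hW).mdiffAt_of_infty,
    h.mvfderiv_γ hZ' (hP hV hX).mdiffAt_of_infty] at hg
  have ht := cov_torsionFree h.torsion_eq_zero hX.mdiffAt_of_infty hW.mdiffAt_of_infty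
  have hU (v : TangentSpace I x) : L (mlieBracket I X W x) v
      = L (cov W x (X x)) v - L (cov X x (W x)) v := by
    rw [ht, map_sub, sub_apply]
  simp only [curvatureField, covDerivTwoField, map_sub, sub_apply, hL, hU] at hg ⊢
  rw [hLs (X x) (cov Z x (W x)), hLs (X x) (cov V x (W x)), hLs (W x) (cov Z x (X x)),
    hLs (W x) (cov V x (X x))] at *
  linear_combination -hg

/-- The trace of the curvature is the exterior derivative of `s`. -/
lemma IsNull.trace_curvatureEnd (hX : CMDiffAt ∞ (T% X) x) (hW : CMDiffAt ∞ (T% W) x) :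
    LinearMap.trace ℝ _ (curvatureEnd cov X W x)
      = covDerivOneField cov D.s W x (X x) - covDerivOneField cov D.s X x (W x) := by
  have hP := h.preservesSmooth
  have he (v : TangentSpace I x) : CMDiffAt ∞ (T% (extend E v)) x := contMDiffAt_extend ..
  obtain ⟨L, hL⟩ := D.exists_U x
  obtain ⟨K, hK⟩ := D.exists_F x
  have hLs (v w) : L v w = L w v := by rw [← hL, ← hL, D.U_symm]
  set R := curvatureEnd cov X W x
  have hRe (c : TangentSpace I x) : R c = curvatureField cov X W (extend E c) x := by
    rw [← curvatureEnd_apply hP hX hW (he c), extend_apply_self]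
  -- Q is one quarter of the right side of the Ricci identity for γ, with ∇U already expressed
  -- through ∇²n; the full side is Q symmetrized in c, d and antisymmetrized in X, W.
  let Q (X W : ∀ x : M, TangentSpace I x) (c d : TangentSpace I x) : ℝ :=
    (D.γ x (secondCov cov D.n W x (X x)) c - L (X x) (cov D.n x (W x)) * D.ℓ x c
      - L (X x) c * D.s x (W x)) * D.ℓ x d + L (W x) c * (K (X x) d - D.ℓ₂ x * L (X x) d)
  have hQ {X W : ∀ x : M, TangentSpace I x} :
      D.contractP x (Q X W) = K (X x) (cov D.n x (W x)) + D.s x (W x) * D.s x (X x) := by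
    have h1 := hD.contractP_mul_ℓ x
      ((D.γ x (secondCov cov D.n W x (X x)) - L (X x) (cov D.n x (W x)) • D.ℓ x
        - D.s x (W x) • L (X x) : TangentSpace I x →L[ℝ] ℝ) : TangentSpace I x →ₗ[ℝ] ℝ)
    have h2 := hD.contractP_mul_U h x
      ((K (X x) - D.ℓ₂ x • L (X x) : TangentSpace I x →L[ℝ] ℝ) : TangentSpace I x →ₗ[ℝ] ℝ) (W x)
    rw [← D.contractP_swap x] at h2
    simp only [ContinuousLinearMap.coe_coe, sub_apply, smul_apply, smul_eq_mul, hD.γ_n_right,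
      hD.ℓ_n, ← hL, hD.U_n_right, ← hK] at h1 h2
    have hs : D.F x (X x) (D.n x) = -D.s x (X x) := F_antisymm x _ _
    have h3 : Q X W = fun c d ↦ (D.γ x (secondCov cov D.n W x (X x)) c
        - D.U x (X x) (cov D.n x (W x)) * D.ℓ x c - D.s x (W x) * D.U x (X x) c) * D.ℓ x d
        + (D.F x (X x) d - D.ℓ₂ x * D.U x (X x) d) * D.U x c (W x) := by
      funext c d
      simp only [Q, hL, hK]
      rw [hLs c]
      ring
    rw [h3, contractP_add, h1, h2, hs, hK]
    ring
  have h1 (c d : TangentSpace I x) : D.γ x (R c) d + D.γ x (R d) c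
      = (Q X W c d + Q X W d c) - (Q W X c d + Q W X d c) := by
    have := hD.ricci_identity_γ h hX hW (he c) (he d)
    simp only [hD.covDerivTwoField_U h hX (he _), hD.covDerivTwoField_U h hW (he _),
      extend_apply_self, ← hRe, hL, hK] at this
    rw [D.γ_symm x (R d), this]
    simp only [Q]
    ring
  -- P is symmetric, so each symmetrization in c, d contracts to a factor 2.
  have h2 : 2 * D.contractP x (fun c d ↦ D.γ x (R c) d)
      = 2 * D.contractP x (Q X W) - 2 * D.contractP x (Q W X) := by
    have h3 : (fun c d ↦ D.γ x (R c) d + D.γ x (R d) c)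
        = fun c d ↦ (Q X W c d + Q X W d c) - (Q W X c d + Q W X d c) := by
      funext c d
      exact h1 c d
    have h4 := congrArg (D.contractP x) h3
    rw [contractP_add, D.contractP_sub x (fun c d ↦ Q X W c d + Q X W d c)
      (fun c d ↦ Q W X c d + Q W X d c), D.contractP_add x (Q X W) (fun c d ↦ Q X W d c),
      D.contractP_add x (Q W X) (fun c d ↦ Q W X d c),
      D.contractP_swap x (Q X W), D.contractP_swap x (Q W X),
      D.contractP_swap x (fun c d ↦ D.γ x (R c) d)] at h4
    linear_combination h4
  rw [hD.contractP_γ, hQ, hQ] at h2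
  -- The P-contraction misses ℓ(R(X, W)n) from the trace. It supplies the antisymmetrized ∇s, and
  -- its F-terms cancel those from Q.
  have h5 : R (D.n x) = secondCov cov D.n W x (X x) - secondCov cov D.n X x (W x) := by
    rw [← curvatureField_eq_secondCov h.torsion_eq_zero hX hW]
    exact curvatureEnd_apply hP hX hW D.contMDiffAt_n
  have h6 : D.U x (W x) (cov D.n x (X x)) = D.U x (X x) (cov D.n x (W x)) := by
    rw [← hD.γ_cov_n h, ← hD.γ_cov_n h, D.γ_symm]
  rw [h5, map_sub, hD.ℓ_secondCov h hW, hD.ℓ_secondCov h hX, h6, hK, hK] at h2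
  linear_combination (1 / 2) * h2

end MetricHypersurfaceData

end SecondOrder

/-! ### The constraint tensor contracted with n. -/

section Constraint

namespace HypersurfaceData

variable {E : Type*} [NormedAddCommGroup E] [NormedSpace ℝ E] [FiniteDimensional ℝ E]
  {H : Type*} [TopologicalSpace H] {I : ModelWithCorners ℝ E H}
  {M : Type*} [TopologicalSpace M] [ChartedSpace H M] [IsManifold I ∞ M]
  (D : HypersurfaceData I M) {x : M} {Z W : ∀ x : M, TangentSpace I x}

lemma r_n (x : M) : D.r x (D.n x) = -D.κ x := by
  simp [r, κ]

lemma contMDiffAt_r (hZ : CMDiffAt ∞ (T% Z) x) : CMDiffAt ∞ (fun y ↦ D.r y (Z y)) x :=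
  MetricHypersurfaceData.contMDiffAt_apply₂ (D.Y_smooth x) D.contMDiffAt_n hZ

lemma contMDiffAt_κ : CMDiffAt ∞ D.κ x :=
  (MetricHypersurfaceData.contMDiffAt_apply₂ (D.Y_smooth x) D.contMDiffAt_n
    D.contMDiffAt_n).neg

lemma mlieBracket_n (hW : MDiffAt (T% W) x) :
    mlieBracket I D.n W x = D.connection W x (D.n x) - D.connection D.n x (W x) :=
  cov_torsionFree D.connection_spec.torsion_eq_zero D.mdiff_n hW

variable (hD : D.IsNull)
include hD

/-- The symmetric part is Ric(n, w) minus half the antisymmetric difference. The former comes from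
the contracted Ricci identity, the latter from the trace of the curvature. -/
lemma ricci_symm_n (x : M) (w : TangentSpace I x) :
    1 / 2 * (ricci D.connection x (D.n x) w + ricci D.connection x w (D.n x))
      = LinearMap.trace ℝ (TangentSpace I x) (secondCov D.connection D.n (extend E w) x)
        - d% D.trU x w - 1 / 2 * (covDerivOneField D.connection D.s (extend E w) x (D.n x)
          + D.s x (D.connection D.n x w)) := by
  have hc := D.connection_spec
  have he (v : TangentSpace I x) : CMDiffAt ∞ (T% (extend E v)) x := contMDiffAt_extend ..
  have h1 := ricci_apply_field hc.torsion_eq_zero hc.preservesSmooth D.contMDiffAt_n w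
  have h2 := ricci_sub_ricci hc.torsion_eq_zero hc.preservesSmooth x (D.n x) w
  have h3 := hD.trace_curvatureEnd hc (he (D.n x)) (he w)
  -- By tensoriality n itself may replace the extension of n(x), and s(n) = 0 holds everywhere.
  have h4 : covDerivOneField D.connection D.s (extend E (D.n x)) x w
      = -D.s x (D.connection D.n x w) := by
    have := covDerivOneField_congr (cov := D.connection) (θ := D.sLinear)
      (by simpa only [MetricHypersurfaceData.sLinear_apply] using fun Z ↦ hD.contMDiffAt_s hc)
      (he (D.n x)) D.contMDiffAt_n (by simp) w
    simp only [MetricHypersurfaceData.sLinear_apply] at this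
    rw [this, covDerivOneField]
    simp [MetricHypersurfaceData.s_n, mvfderiv_const]
  rw [← hD.trU_eq_trace hc] at h1
  simp only [extend_apply_self, h4] at h3
  linear_combination h1 - (1 / 2) * h2 - (1 / 2) * h3

/-- Without torsion £_n is ∇_n plus contractions with ∇n; since ∇_n n = 0, inserting n commutes with
∇_n and turns Y into r. -/
lemma lieDerivTwo_Y_n (x : M) (w : TangentSpace I x) :
    lieDerivTwo D.n (fun y v w ↦ D.Y y v w) x (D.n x) w
      = covDerivOneField D.connection D.r (extend E w) x (D.n x)
        + D.r x (D.connection D.n x w) := by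
  have hc := D.connection_spec
  have he (v : TangentSpace I x) : CMDiffAt ∞ (T% (extend E v)) x := contMDiffAt_extend ..
  have hm (v : TangentSpace I x) := mdifferentiableAt_extend I E v
  -- The Lie derivative uses an extension of the vector n(x); tensoriality of ∇ for the covector
  -- Y(W, ·), W the extension of w, replaces it by n.
  have h1 := covDerivOneField_congr (cov := D.connection)
    (θ := fun y ↦ (D.Y y (extend E w y) : TangentSpace I y →ₗ[ℝ] ℝ))
    (fun Z hZ ↦ MetricHypersurfaceData.contMDiffAt_apply₂ (D.Y_smooth x) (he w) hZ)
    (he (D.n x)) D.contMDiffAt_n (by simp) (D.n x)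
  simp only [covDerivOneField, ContinuousLinearMap.coe_coe, D.Y_symm _ (extend E w _)] at h1
  simp only [hD.cov_n_n hc, extend_apply_self, map_zero, zero_apply] at h1
  rw [lieDerivTwo, D.mlieBracket_n (hm _), D.mlieBracket_n (hm _)]
  simp only [covDerivOneField, extend_apply_self, map_sub, sub_apply, hD.cov_n_n hc, map_zero,
    zero_apply]
  simp only [r] at h1 ⊢
  linear_combination h1

lemma lieDerivOne_r_sub_s (x : M) (w : TangentSpace I x) :
    lieDerivOne D.n (fun y z ↦ D.r y z - D.s y z) x w
      = covDerivOneField D.connection D.r (extend E w) x (D.n x)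
        + D.r x (D.connection D.n x w)
        - covDerivOneField D.connection D.s (extend E w) x (D.n x)
        - D.s x (D.connection D.n x w) := by
  have hc := D.connection_spec
  have he : CMDiffAt ∞ (T% (extend E w)) x := contMDiffAt_extend ..
  have h1 : d% (fun y ↦ D.r y (extend E w y) - D.s y (extend E w y)) x (D.n x)
      = d% (fun y ↦ D.r y (extend E w y)) x (D.n x)
        - d% (fun y ↦ D.s y (extend E w y)) x (D.n x) := by
    rw [mvfderiv_fun_sub (D.contMDiffAt_r he).mdiffAt_of_infty
      (hD.contMDiffAt_s hc he).mdiffAt_of_infty]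
    rfl
  rw [lieDerivOne, D.mlieBracket_n he.mdiffAt_of_infty, h1]
  simp only [covDerivOneField, extend_apply_self, ← MetricHypersurfaceData.sLinear_apply, map_sub,
    r]
  ring

lemma covDerivOne_s_add_r (x : M) (w : TangentSpace I x) :
    covDerivOne D.connection (fun y z ↦ D.s y z + 2 * D.r y z) x (D.n x) w
      = covDerivOneField D.connection D.s (extend E w) x (D.n x)
        + 2 * covDerivOneField D.connection D.r (extend E w) x (D.n x) := by
  have hc := D.connection_spec
  have he : CMDiffAt ∞ (T% (extend E w)) x := contMDiffAt_extend ..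
  have h1 : d% (fun y ↦ D.s y (extend E w y) + 2 * D.r y (extend E w y)) x (D.n x)
      = d% (fun y ↦ D.s y (extend E w y)) x (D.n x)
        + 2 * d% (fun y ↦ D.r y (extend E w y)) x (D.n x) := by
    rw [mvfderiv_fun_add (g' := fun y ↦ 2 * D.r y (extend E w y))
      (hD.contMDiffAt_s hc he).mdiffAt_of_infty
      (contMDiffAt_const.mul (D.contMDiffAt_r he)).mdiffAt_of_infty,
      mvfderiv_fun_mul mdifferentiableAt_const (D.contMDiffAt_r he).mdiffAt_of_infty,
      mvfderiv_const]
    simp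
  rw [covDerivOne, covDerivOneField, h1]
  simp only [covDerivOneField]
  ring

/-- Differentiate (s + 2r)(n) = -2κ_n along w. -/
lemma covDerivOne_s_add_r_n (x : M) (w : TangentSpace I x) :
    covDerivOne D.connection (fun y z ↦ D.s y z + 2 * D.r y z) x w (D.n x)
      = -2 * d% D.κ x w - D.s x (D.connection D.n x w) - 2 * D.r x (D.connection D.n x w) := by
  have hc := D.connection_spec
  have he (v : TangentSpace I x) : CMDiffAt ∞ (T% (extend E v)) x := contMDiffAt_extend ..
  have h1 := covDerivOneField_congr (cov := D.connection)
    (θ := fun y ↦ D.sLinear y + (2 : ℝ) • (D.Y y (D.n y) : TangentSpace I y →ₗ[ℝ] ℝ))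
    (fun Z hZ ↦ by
      simp only [LinearMap.add_apply, LinearMap.smul_apply, smul_eq_mul,
        MetricHypersurfaceData.sLinear_apply, ContinuousLinearMap.coe_coe]
      exact (hD.contMDiffAt_s hc hZ).add (contMDiffAt_const.mul (D.contMDiffAt_r hZ)))
    (he (D.n x)) D.contMDiffAt_n (by simp) w
  simp only [LinearMap.add_apply, LinearMap.smul_apply, smul_eq_mul,
        MetricHypersurfaceData.sLinear_apply, ContinuousLinearMap.coe_coe] at h1
  refine h1.trans ?_
  have h2 : (fun y ↦ D.s y (D.n y) + 2 * D.Y y (D.n y) (D.n y)) = fun y ↦ -2 * D.κ y := by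
    funext y
    rw [MetricHypersurfaceData.s_n, κ]
    ring
  rw [covDerivOneField, h2, mvfderiv_fun_mul mdifferentiableAt_const
    D.contMDiffAt_κ.mdiffAt_of_infty, mvfderiv_const]
  simp [r]
  ring

/-- The contraction `𝓡(n, ·)` of the constraint tensor of null hypersurface data. -/
theorem constraintTensor_n (x : M) (w : TangentSpace I x) :
    D.constraintTensor x (D.n x) w =
      -d% D.κ x w
        - lieDerivOne D.n (fun y z ↦ D.r y z - D.s y z) x w
        - D.trU x * (D.r x w - D.s x w)
        - d% D.trU x w
        + D.contractP x (fun c d ↦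
            covDerivTwo D.connection D.U x c w d - 2 * D.U x w d * D.s x c) := by
  have hc := D.connection_spec
  have he (v : TangentSpace I x) : CMDiffAt ∞ (T% (extend E v)) x := contMDiffAt_extend ..
  obtain ⟨K, hK⟩ := D.exists_F x
  have h1 := hD.contractP_mul_U hc x (((2 : ℝ) • D.Y x (D.n x) + K (D.n x) :
    TangentSpace I x →L[ℝ] ℝ) : TangentSpace I x →ₗ[ℝ] ℝ) w
  have h2 := hD.contractP_mul_U hc x (D.sLinear x) w
  -- U(·, n) = 0 leaves the contraction of U(·, w) with the covector 2r + s, whose value at n is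
  -- -2κ_n. The resulting κ_n s(w) cancels the one from 4 r_{(a} s_{b)}.
  have h3 : D.contractP x (fun c d ↦ D.U x d (D.n x) * (2 * D.Y x w c + D.F x w c)
      + D.U x d w * (2 * D.Y x (D.n x) c + D.F x (D.n x) c))
      = 2 * D.r x (D.connection D.n x w) + D.s x (D.connection D.n x w)
        + 2 * D.κ x * D.s x w := by
    simp only [ContinuousLinearMap.coe_coe, add_apply, smul_apply, smul_eq_mul, ← hK] at h1
    simp only [hD.U_n_right, zero_mul, zero_add, mul_comm (D.U x _ w), h1]
    have h4 := D.r_n x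
    have h5 : D.F x (D.n x) (D.n x) = 0 := MetricHypersurfaceData.s_n x
    rw [h5, show D.Y x (D.n x) (D.n x) = -D.κ x from h4]
    simp only [r, MetricHypersurfaceData.s]
    ring
  have h4 : D.contractP x (fun c d ↦
      covDerivTwo D.connection D.U x c w d - 2 * D.U x w d * D.s x c)
      = LinearMap.trace ℝ (TangentSpace I x) (secondCov D.connection D.n (extend E w) x)
        - D.ℓ x (secondCov D.connection D.n (extend E w) x (D.n x)) - D.trU x * D.s x w
        - 2 * D.s x (D.connection D.n x w) := by
    simp only [MetricHypersurfaceData.sLinear_apply, MetricHypersurfaceData.s_n, mul_zero,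
      sub_zero] at h2
    rw [MetricHypersurfaceData.contractP_sub, hD.contractP_covDerivTwo_U hc]
    have h5 : (fun c d ↦ 2 * D.U x w d * D.s x c) = fun c d ↦ 2 * (D.s x c * D.U x d w) := by
      funext c d
      rw [D.U_symm x d w]
      ring
    rw [h5, MetricHypersurfaceData.contractP_mul_left, h2]
  have h5 := hD.ℓ_secondCov hc (he w) (D.n x)
  simp only [extend_apply_self, hD.U_n_left] at h5
  rw [constraintTensor, D.ricci_symm_n hD, D.lieDerivTwo_Y_n hD, D.covDerivOne_s_add_r hD,
    D.covDerivOne_s_add_r_n hD, h3, h4, h5, D.lieDerivOne_r_sub_s hD, D.r_n,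
    MetricHypersurfaceData.s_n, hD.U_n_left]
  simp only [r, MetricHypersurfaceData.s]
  ring

/-- The contraction `𝓡(n, n)` of the constraint tensor of null hypersurface data. -/
theorem constraintTensor_n_n (x : M) :
    D.constraintTensor x (D.n x) (D.n x) =
      -d% D.trU x (D.n x) + D.trU x * D.κ x
        - D.contractP x (fun a b ↦ D.contractP x (fun c d ↦ D.U x a c * D.U x b d)) := by
  have hc := D.connection_spec
  have he (v : TangentSpace I x) : CMDiffAt ∞ (T% (extend E v)) x := contMDiffAt_extend ..
  obtain ⟨L, hL⟩ := D.exists_U x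
  have h1 (c d : TangentSpace I x) : covDerivTwo D.connection D.U x c (D.n x) d
      = -1 * D.U x c (D.connection D.n x d) := by
    have h2 := hD.covDerivTwoField_U hc (he d) (he (D.n x)) c
    -- Moving n to the second slot by symmetry of U makes the formula for ∇U collapse: γ(·, n) and
    -- U(c, n) vanish and ℓ(n) = 1.
    have h3 : covDerivTwo D.connection D.U x c (D.n x) d
        = covDerivTwoField D.connection D.U (extend E d) (extend E (D.n x)) x c := by
      simp only [covDerivTwo, covDerivTwoField, D.U_symm _ (extend E (D.n x) _),
        D.U_symm x (D.connection (extend E (D.n x)) x c)]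
      ring
    rw [h3, h2]
    simp [hD.γ_n_right, hD.ℓ_n, hD.U_n_right]
  have h2 (a b : TangentSpace I x) : D.contractP x (fun c d ↦ D.U x a c * D.U x b d)
      = D.U x a (D.connection D.n x b) := by
    have h3 := hD.contractP_mul_U hc x (L a : TangentSpace I x →ₗ[ℝ] ℝ) b
    simp only [ContinuousLinearMap.coe_coe, ← hL, hD.U_n_right, mul_zero, sub_zero] at h3
    simp only [D.U_symm x b, h3]
  have h3 : D.contractP x (fun c d ↦
      covDerivTwo D.connection D.U x c (D.n x) d - 2 * D.U x (D.n x) d * D.s x c)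
      = -D.contractP x (fun a b ↦ D.U x a (D.connection D.n x b)) := by
    simp only [h1, hD.U_n_left, mul_zero, zero_mul, sub_zero]
    rw [MetricHypersurfaceData.contractP_mul_left]
    ring
  -- This cancels the term -n(κ_n) of the first formula. The two evaluations of ∇(s + 2r) at (n, n),
  -- with (∇_n s)(n) = 0, give (∇_n r)(n) = -n(κ_n).
  have h4 : lieDerivOne D.n (fun y z ↦ D.r y z - D.s y z) x (D.n x) = -d% D.κ x (D.n x) := by
    have h5 := D.covDerivOne_s_add_r_n hD x (D.n x)
    have h6 := D.covDerivOne_s_add_r hD x (D.n x)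
    have h7 : covDerivOneField D.connection D.s (extend E (D.n x)) x (D.n x) = 0 := by
      have := covDerivOneField_congr (cov := D.connection) (θ := D.sLinear)
        (by simpa only [MetricHypersurfaceData.sLinear_apply] using fun Z ↦ hD.contMDiffAt_s hc)
        (he (D.n x)) D.contMDiffAt_n (by simp) (D.n x)
      simp only [MetricHypersurfaceData.sLinear_apply] at this
      rw [this, covDerivOneField, hD.cov_n_n hc, ← MetricHypersurfaceData.sLinear_apply]
      simp [MetricHypersurfaceData.s_n, mvfderiv_const]
    rw [D.lieDerivOne_r_sub_s hD, hD.cov_n_n hc]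
    rw [hD.cov_n_n hc] at h5
    have h8 : D.s x 0 = 0 := by rw [← MetricHypersurfaceData.sLinear_apply, map_zero]
    have h9 : D.r x 0 = 0 := by simp [r]
    rw [h8, h9] at h5 ⊢
    linear_combination (1 / 2) * h5 - (1 / 2) * h6 - (3 / 2) * h7
  rw [D.constraintTensor_n hD, h3, h4, D.r_n, MetricHypersurfaceData.s_n]
  simp only [h2]
  ring

end HypersurfaceData

end Constraint

/-- The contractions `𝓡(n, ·)` and `𝓡(n, n)` of the constraint tensor of null hypersurface data. -/
theorem theorem5p2 {𝔫 : ℕ} {N : Type*} [TopologicalSpace N]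
    [ChartedSpace (EuclideanSpace ℝ (Fin 𝔫)) N] [IsManifold (𝓡 𝔫) ∞ N]
    (D : HypersurfaceData (𝓡 𝔫) N) (hD : D.IsNull) (x : N) :
    (∀ w : TangentSpace (𝓡 𝔫) x,
      D.constraintTensor x (D.n x) w =
        -mvfderiv (𝓡 𝔫) D.κ x w
          - lieDerivOne D.n (fun y z ↦ D.r y z - D.s y z) x w
          - D.trU x * (D.r x w - D.s x w)
          - mvfderiv (𝓡 𝔫) D.trU x w
          + D.contractP x (fun c d ↦
              covDerivTwo D.connection D.U x c w d - 2 * D.U x w d * D.s x c))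
    ∧ D.constraintTensor x (D.n x) (D.n x) =
        -mvfderiv (𝓡 𝔫) D.trU x (D.n x) + D.trU x * D.κ x
          - D.contractP x (fun a b ↦ D.contractP x (fun c d ↦ D.U x a c * D.U x b d)) :=
  ⟨D.constraintTensor_n hD x, D.constraintTensor_n_n hD x⟩
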